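/- Let $X$ be a (real or complex) Hilbert space, $U$ a Banach space over the same field, and let $A:D(A)\to X$ be the infinitesimal generator of a $C_0$-semigroup $(T(t))_{t\ge 0}$ on $X$. Consider the generalized bilinear system $$\dot x(t)=Ax(t)+Bu(t)+C(x(t),u(t)),\qquad x(0)=\phi_0\in X,$$ where $B:U\to X$ is bounded and linear and $C:X\times U\to X$ satisfies $\|C(x,v)\|_X\le K\|x\|_X\,\xi(\|v\|_U)$ for all $x\in X$, $v\in U$, with some $K>0$ and $\xi\in\mathcal K$. Inputs $u$ are continuous functions $[0,\infty)\to U$. Put $f(x,v)=Bv+C(x,v)$. The solution $\phi(\cdot,\phi_0,u)$ is understood as the function $x$ with $x\in C([0,\tau],X)$ for all $\tau>0$ and $x(t)=T(t)\phi_0+\int_0^tT(t-s)f(x(s),u(s))\,ds$ for $t\ge0$. Assume (Assumption 1) that $f(x,\cdot)$ is continuous for every $x\in X$ and that for every $w>0$ there is $L(w)>0$ such that $\|f(y,v)-f(x,v)\|_X\le L(w)\|y-x\|_X$ whenever $\|x\|_X,\|y\|_X\le w$ and $v\in U$. Assume further that $P\in L(X)$ is self-adjoint, positive ($\langle Px,x\rangle>0$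 for $x\neq0$) and coercive ($\langle Px,x\rangle\ge k\|x\|_X^2$ for all $x\in X$ and some $k>0$), and that $$\langle Ax,Px\rangle+\langle Px,Ax\rangle=-\|x\|_X^2\qquad\text{for all }x\in D(A).$$ Let $W(x)=\ln(1+\langle Px,x\rangle)$. 1. If the semigroup generated by $A$ is analytic, then the system is iISS and $W$ is an iISS Lyapunov function for it (on $X$). 2. If (the semigroup being analytic or not) every trajectory that starts in $D(A)$, under an arbitrary input, remains in $D(A)$, then the system is iISS and $W$ is an iISS Lyapunov function for it on $D(A)$. Here $\mathcal{PD}$ is the class of continuous $\gamma:[0,\infty)\to[0,\infty)$ with $\gamma(0)=0$ and $\gamma(r)>0$ for $r>0$; $\mathcal K$ consists of the strictly increasing ones, $\mathcal K_\infty$ of the unbounded functions in $\mathcal K$; $\mathcal{KL}$ consists of the continuous $\beta:[0,\infty)^2\to[0,\infty)$ such that $\beta(\cdot,t)\in\mathcal K$ for all $t\ge0$ and $\beta(r,\cdot)$ is strictly decreasing with limit $0$ for all $r>0$. The system is *iISS* if for all $\phi_0\in X$ and all inputs $u$ the solution exists, uniquely, on $[0,\infty)$, and there are $\theta\in\mathcal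 K_\infty$, $\mu\in\mathcal K$, $\beta\in\mathcal{KL}$ with $\|\phi(t,\phi_0,u)\|_X\le\beta(\|\phi_0\|_X,t)+\theta\big(\int_0^t\mu(\|u(s)\|_U)\,ds\big)$ for all $\phi_0\in X$, all $u$ and all $t\ge0$. A function $V:X\to[0,\infty)$ is an *iISS Lyapunov function on* $S\subseteq X$ if its restriction to $S$ is continuous and there are $\psi_1,\psi_2\in\mathcal K_\infty$, $\alpha\in\mathcal{PD}$, $\sigma\in\mathcal K$ such that, for all $x\in S$ and all inputs $u$, $\psi_1(\|x\|_X)\le V(x)\le\psi_2(\|x\|_X)$ and $\limsup_{t\to+0}\frac1t\big(V(\phi(t,x,u))-V(x)\big)\le-\alpha(\|x\|_X)+\sigma(\|u(0)\|_U)$. -/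

import Mathlib

open Filter Topology Set

noncomputable section

namespace IISS

/-! ### Comparison functions

Functions on `[0, ∞)` are represented by functions on `ℝ` of which only the values on `[0, ∞)`
are used. -/

/-- Positive definite functions. -/
structure ClassPD (γ : ℝ → ℝ) : Prop where
  continuousOn : ContinuousOn γ (Ici 0)
  map_zero : γ 0 = 0
  pos : ∀ r, 0 < r → 0 < γ r

structure ClassK (γ : ℝ → ℝ) : Prop extends ClassPD γ where
  strictMonoOn : StrictMonoOn γ (Ici 0)

structure ClassKInfty (γ : ℝ → ℝ) : Prop extends ClassK γ where
  unbounded : ∀ M : ℝ, ∃ r, 0 ≤ r ∧ M < γ r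

structure ClassL (γ : ℝ → ℝ) : Prop where
  nonneg : ∀ t, 0 ≤ t → 0 ≤ γ t
  continuousOn : ContinuousOn γ (Ici 0)
  strictAntiOn : StrictAntiOn γ (Ici 0)
  tendsto_zero : Tendsto γ atTop (𝓝 0)

structure ClassKL (β : ℝ → ℝ → ℝ) : Prop where
  continuousOn : ContinuousOn (fun p : ℝ × ℝ => β p.1 p.2) (Ici 0 ×ˢ Ici 0)
  classK : ∀ t, 0 ≤ t → ClassK (fun r => β r t)
  classL : ∀ r, 0 < r → ClassL (fun t => β r t)

/-! ### Strongly continuous semigroups -/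

/-- A `C₀`-semigroup on `X`; only the operators `T t` with `0 ≤ t` are meaningful. -/
structure C0Semigroup (𝕜 X : Type*) [RCLike 𝕜] [NormedAddCommGroup X] [NormedSpace 𝕜 X] where
  toFun : ℝ → X →L[𝕜] X
  map_zero : toFun 0 = ContinuousLinearMap.id 𝕜 X
  map_add : ∀ s t, 0 ≤ s → 0 ≤ t → toFun (s + t) = (toFun s).comp (toFun t)
  tendsto_zero : ∀ x, Tendsto (fun t => toFun t x) (𝓝[>] 0) (𝓝 x)

namespace C0Semigroup

section Generator

variable {𝕜 X : Type*} [RCLike 𝕜] [NormedAddCommGroup X] [NormedSpace 𝕜 X]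

instance : CoeFun (C0Semigroup 𝕜 X) (fun _ => ℝ → X →L[𝕜] X) := ⟨C0Semigroup.toFun⟩

/-- `y` is the limit of `(T(t)x - x) / t` as `t → 0+`, that is, `x ∈ D(A)` and `A x = y`. -/
def HasGeneratorAt (T : C0Semigroup 𝕜 X) (x y : X) : Prop :=
  Tendsto (fun t : ℝ => ((t⁻¹ : ℝ) : 𝕜) • (T t x - x)) (𝓝[>] 0) (𝓝 y)

theorem HasGeneratorAt.add {T : C0Semigroup 𝕜 X} {x y x' y' : X}
    (h : T.HasGeneratorAt x y) (h' : T.HasGeneratorAt x' y') :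
    T.HasGeneratorAt (x + x') (y + y') := by
  refine (Tendsto.add h h').congr fun t => ?_
  rw [_root_.map_add, ← smul_add]
  congr 1
  abel

theorem HasGeneratorAt.smul {T : C0Semigroup 𝕜 X} {x y : X} (c : 𝕜)
    (h : T.HasGeneratorAt x y) : T.HasGeneratorAt (c • x) (c • y) := by
  refine (Tendsto.const_smul h c).congr fun t => ?_
  rw [map_smul, ← smul_sub, smul_comm]

theorem HasGeneratorAt.zero (T : C0Semigroup 𝕜 X) : T.HasGeneratorAt 0 0 := by
  simp [HasGeneratorAt]

/-- The domain `D(A)` of the infinitesimal generator. -/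
def domain (T : C0Semigroup 𝕜 X) : Submodule 𝕜 X where
  carrier := {x | ∃ y, T.HasGeneratorAt x y}
  add_mem' := fun ⟨y, hy⟩ ⟨y', hy'⟩ => ⟨y + y', hy.add hy'⟩
  zero_mem' := ⟨0, HasGeneratorAt.zero T⟩
  smul_mem' := fun c _ ⟨y, hy⟩ => ⟨c • y, hy.smul c⟩

/-- The infinitesimal generator `A : D(A) → X`, `A x = lim_{t → 0+} (T(t)x - x) / t`. -/
def generator (T : C0Semigroup 𝕜 X) : X →ₗ.[𝕜] X where
  domain := T.domain
  toFun :=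
    { toFun := fun x => Classical.choose x.2
      map_add' := fun x x' => tendsto_nhds_unique (Classical.choose_spec (x + x').2)
        (HasGeneratorAt.add (Classical.choose_spec x.2) (Classical.choose_spec x'.2))
      map_smul' := fun c x => tendsto_nhds_unique (Classical.choose_spec (c • x).2)
        (HasGeneratorAt.smul c (Classical.choose_spec x.2)) }

theorem hasGeneratorAt_generator (T : C0Semigroup 𝕜 X) (x : T.generator.domain) :
    T.HasGeneratorAt (x : X) (T.generator x) :=
  Classical.choose_spec x.2

end Generator

section Analytic

variable {𝕜 X : Type*} [RCLike 𝕜] [NormedAddCommGroup X] [InnerProductSpace 𝕜 X]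

/-- The open sector `{z ≠ 0 : |arg z| < θ}` in the complex plane. -/
def sector (θ : ℝ) : Set ℂ := {z | z ≠ 0 ∧ |z.arg| < θ}

/-- `T` is an analytic semigroup: it extends holomorphically from `(0, ∞)` to a sector around the
positive half-axis, with operator norms that stay bounded near `0` in the sector. For real scalars
the extended operators act on the complexification of `X`; to treat real and complex Hilbert spaces
at once the extension `T(z)` is given by its matrix coefficients `F z x y = ⟨T(z) x, y⟩`. (Weak and
strong holomorphy agree, and linearity in `x`, `y`, the semigroup law in the sector and
`T(z) x → x` as `z → 0` in the sector follow by the identity theorem and the bound.) -/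
def IsAnalytic (T : C0Semigroup 𝕜 X) : Prop :=
  ∃ θ : ℝ, 0 < θ ∧ θ ≤ Real.pi / 2 ∧ ∃ F : ℂ → X → X → ℂ,
    (∀ x y, DifferentiableOn ℂ (fun z => F z x y) (sector θ)) ∧
    (∃ M : ℝ, ∀ z ∈ sector θ, ‖z‖ ≤ 1 → ∀ x y, ‖F z x y‖ ≤ M * ‖x‖ * ‖y‖) ∧
    (∀ t : ℝ, 0 < t → ∀ x y, F (t : ℂ) x y =
      (RCLike.re (inner 𝕜 y (T t x)) : ℂ) + (RCLike.im (inner 𝕜 y (T t x)) : ℂ) * Complex.I)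

end Analytic

end C0Semigroup

/-! ### The control system `x' = A x + f(x, u)` -/

section System

variable {𝕜 X U : Type*} [RCLike 𝕜] [NormedAddCommGroup X] [NormedSpace 𝕜 X] [NormedSpace ℝ X]
  [NormedAddCommGroup U]

/-- `f` is Lipschitz on bounded subsets of `X`, uniformly in the second argument, and continuous
in the second argument. -/
structure NonlinearityAssumption (f : X → U → X) : Prop where
  lipschitz : ∀ w : ℝ, 0 < w → ∃ L : ℝ, 0 < L ∧ ∀ x y : X, ‖x‖ ≤ w → ‖y‖ ≤ w →
    ∀ v : U, ‖f y v - f x v‖ ≤ L * ‖y - x‖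
  continuous : ∀ x : X, Continuous (f x)

/-- Admissible inputs: continuous functions `[0, ∞) → U`. -/
def IsInput (u : ℝ → U) : Prop := ContinuousOn u (Ici 0)

/-- `x ∈ C([0, τ], X)` solves `x(t) = T(t) x₀ + ∫₀ᵗ T(t - s) f(x(s), u(s)) ds` on `[0, τ]`. -/
def IsSolutionOn (T : C0Semigroup 𝕜 X) (f : X → U → X) (x₀ : X) (u : ℝ → U) (τ : ℝ)
    (x : ℝ → X) : Prop :=
  ContinuousOn x (Icc 0 τ) ∧
    ∀ t ∈ Icc 0 τ, x t = T t x₀ + ∫ s in (0 : ℝ)..t, T (t - s) (f (x s) (u s))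

/-- `x = φ(·, x₀, u)` is a (global) solution. -/
def IsSolution (T : C0Semigroup 𝕜 X) (f : X → U → X) (x₀ : X) (u : ℝ → U) (x : ℝ → X) : Prop :=
  ∀ τ : ℝ, 0 < τ → IsSolutionOn T f x₀ u τ x

/-- The transition map `φ(t, x₀, u)` is well defined for all `t ≥ 0`: for every initial state and
input there is exactly one global solution. -/
def HasTransitionMap (T : C0Semigroup 𝕜 X) (f : X → U → X) : Prop :=
  ∀ (x₀ : X) (u : ℝ → U), IsInput u →
    ∃ x, IsSolution T f x₀ u x ∧ ∀ y, IsSolution T f x₀ u y → EqOn y x (Ici 0)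

/-- Integral input-to-state stability (in particular, all solutions exist on `[0, ∞)`). -/
def IsIISS (T : C0Semigroup 𝕜 X) (f : X → U → X) : Prop :=
  HasTransitionMap T f ∧
    ∃ (θ μ : ℝ → ℝ) (β : ℝ → ℝ → ℝ), ClassKInfty θ ∧ ClassK μ ∧ ClassKL β ∧
      ∀ (x₀ : X) (u : ℝ → U) (x : ℝ → X), IsInput u → IsSolution T f x₀ u x →
        ∀ t, 0 ≤ t → ‖x t‖ ≤ β ‖x₀‖ t + θ (∫ s in (0 : ℝ)..t, μ ‖u s‖)

/-- The upper right Dini derivative at `0` of `t ↦ V(x(t))`; along the solution with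
`x(0) = x₀` and input `u` this is the Lie derivative of `V` at `x₀`. -/
def lieDerivative (V : X → ℝ) (x : ℝ → X) : EReal :=
  limsup (fun t : ℝ => (((1 / t) * (V (x t) - V (x 0)) : ℝ) : EReal)) (𝓝[>] 0)

/-- `V` is an iISS Lyapunov function on the set `S` of states (with all continuous inputs); the
dissipation inequality is required along every solution, however short, starting in `S`. -/
def IsIISSLyapunovFunctionOn (T : C0Semigroup 𝕜 X) (f : X → U → X) (S : Set X) (V : X → ℝ) :
    Prop :=
  ContinuousOn V S ∧
    ∃ ψ₁ ψ₂ α σ : ℝ → ℝ, ClassKInfty ψ₁ ∧ ClassKInfty ψ₂ ∧ ClassPD α ∧ ClassK σ ∧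
      (∀ x ∈ S, ψ₁ ‖x‖ ≤ V x ∧ V x ≤ ψ₂ ‖x‖) ∧
      ∀ x₀ ∈ S, ∀ (u : ℝ → U) (τ : ℝ) (x : ℝ → X), IsInput u → 0 < τ →
        IsSolutionOn T f x₀ u τ x →
          lieDerivative V x ≤ ((-α ‖x₀‖ + σ ‖u 0‖ : ℝ) : EReal)

/-- `V` is an iISS Lyapunov function on the whole state space. -/
def IsIISSLyapunovFunction (T : C0Semigroup 𝕜 X) (f : X → U → X) (V : X → ℝ) : Prop :=
  IsIISSLyapunovFunctionOn T f univ V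

/-- All trajectories that start in `D(A)`, for arbitrary inputs, remain in `D(A)`. -/
def DomainInvariant (T : C0Semigroup 𝕜 X) (f : X → U → X) : Prop :=
  ∀ x₀ ∈ T.domain, ∀ (u : ℝ → U) (x : ℝ → X), IsInput u → IsSolution T f x₀ u x →
    ∀ t, 0 ≤ t → x t ∈ T.domain

end System

/-- The right-hand side `B u + C(x, u)` of the generalized bilinear system. -/
def bilinearRHS {𝕜 X U : Type*} [RCLike 𝕜] [NormedAddCommGroup X] [NormedSpace 𝕜 X]
    [NormedAddCommGroup U] [NormedSpace 𝕜 U] (B : U →L[𝕜] X) (C : X → U → X) : X → U → X :=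
  fun x v => B v + C x v

section Lyapunov

variable {𝕜 X : Type*} [RCLike 𝕜] [NormedAddCommGroup X] [InnerProductSpace 𝕜 X]

/-- `⟨Px, x⟩ > 0` for `x ≠ 0`. For a self-adjoint `P` this number is real. -/
def IsPositiveOperator (P : X →L[𝕜] X) : Prop :=
  ∀ x, x ≠ 0 → 0 < RCLike.re (inner 𝕜 (P x) x)

/-- `⟨Px, x⟩ ≥ k ‖x‖²` for some `k > 0`. -/
def IsCoerciveOperator (P : X →L[𝕜] X) : Prop :=
  ∃ k : ℝ, 0 < k ∧ ∀ x, k * ‖x‖ ^ 2 ≤ RCLike.re (inner 𝕜 (P x) x)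

/-- The Lyapunov equation `⟨Ax, Px⟩ + ⟨Px, Ax⟩ = -‖x‖²` on `D(A)`. -/
def SolvesLyapunovEquation (A : X →ₗ.[𝕜] X) (P : X →L[𝕜] X) : Prop :=
  ∀ x : A.domain, inner 𝕜 (A x) (P x) + inner 𝕜 (P x) (A x) = -((‖(x : X)‖ ^ 2 : ℝ) : 𝕜)

/-- `W(x) = ln(1 + ⟨Px, x⟩)`. -/
def logLyapunov (P : X →L[𝕜] X) (x : X) : ℝ :=
  Real.log (1 + RCLike.re (inner 𝕜 (P x) x))

end Lyapunov

end IISS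

end

namespace IISS

namespace C0Semigroup

/-! ### C₀-semigroups: local bounds, joint continuity, density of the generator's domain. -/

section Banach

variable {𝕜 X : Type*} [RCLike 𝕜] [NormedAddCommGroup X] [NormedSpace 𝕜 X]

/-! Put Q(x) = ⟨Px, x⟩ and f(x, v) = Bv + C(x, v). Everything rests on one identity: along a mild
solution, Q has right derivative -‖x‖² + 2 Re⟨Px, f(x, u)⟩. Formally this is the chain rule plus the
Lyapunov equation, but a mild solution need not lie in D(A). So the equation is first integrated
along orbits in D(A), giving Q(T(t)x) = Q(x) - ∫₀ᵗ ‖T(s)x‖² ds. Both sides are continuous in x and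
D(A) is dense, so this holds on all of X (`lyapunov_integral`). Over a short time h a mild solution
is T(h)y plus a term Z(h) with Z(h)/h → g(0), where g is the forcing; expanding the quadratic form
yields the right derivative (`hasDerivWithinAt_energy`).

Fix p > ‖P‖. Young's inequality, the growth bound on C and coercivity give Q' ≤ -Q/(2p) + (1 + Q)
σ(‖u‖). Dividing by 1 + Q absorbs the bilinear factor, which is why the logarithm is the right
Lyapunov function. An integrating factor gives Q(x(t)) ≤ e^I (e^{-t/(2p)} Q(x₀) + I) with I = ∫₀ᵗ
σ(‖u‖); splitting the product of e^I with the decaying term produces the iISS estimate.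

Solutions are global because f grows at most linearly in x for bounded inputs: f is truncated to a
globally Lipschitz map, the truncated equation is solved by contraction, and Gronwall's bound shows
that the truncation is never active.

Semigroup times are written `max 0 t` so that functions of time are continuous on all of ℝ. -/

/-- Uniform boundedness: otherwise there are times tₙ → 0 with ‖T(tₙ)‖ > n, although every sequence
T(tₙ)x converges. -/
theorem exists_bound_near_zero [CompleteSpace X] (T : C0Semigroup 𝕜 X) :
    ∃ δ : ℝ, 0 < δ ∧ ∃ M : ℝ, ∀ t ∈ Icc 0 δ, ‖T t‖ ≤ M := by
  by_contra! h
  have h' : ∀ n : ℕ, ∃ t ∈ Icc (0 : ℝ) (1 / ((n : ℝ) + 1)), (n : ℝ) < ‖T t‖ := fun n =>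
    h (1 / ((n : ℝ) + 1)) (by positivity) n
  choose t ht hlt using h'
  have htz : Tendsto t atTop (𝓝 0) :=
    squeeze_zero (fun n => (ht n).1) (fun n => (ht n).2) tendsto_one_div_add_atTop_nhds_zero_nat
  -- The times tₙ may vanish, so the one-sided limit must include the point 0.
  have hTz : ∀ x, Tendsto (fun s => T s x) (𝓝[≥] 0) (𝓝 x) := fun x => by
    rw [← Ioi_insert, nhdsWithin_insert]
    refine Tendsto.sup ?_ (T.tendsto_zero x)
    rw [tendsto_pure_left]
    intro s hs
    simpa [T.map_zero] using mem_of_mem_nhds hs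
  obtain ⟨M, hM⟩ := banach_steinhaus (g := fun n => T (t n)) fun x => by
    have hx : Tendsto (fun n => T (t n) x) atTop (𝓝 x) :=
      (hTz x).comp (tendsto_nhdsWithin_iff.2 ⟨htz, Eventually.of_forall fun n => (ht n).1⟩)
    obtain ⟨c, hc⟩ := hx.norm.bddAbove_range
    exact ⟨c, fun n => hc ⟨n, rfl⟩⟩
  obtain ⟨n, hn⟩ := exists_nat_gt M
  exact absurd (hM n) (not_le.2 (hn.trans (hlt n)))

theorem exists_bound [CompleteSpace X] (T : C0Semigroup 𝕜 X) (τ : ℝ) :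
    ∃ M : ℝ, 1 ≤ M ∧ ∀ t ∈ Icc 0 τ, ‖T t‖ ≤ M := by
  obtain ⟨δ, hδ, M, hM⟩ := T.exists_bound_near_zero
  have key : ∀ n : ℕ, ∃ N : ℝ, 1 ≤ N ∧ ∀ t ∈ Icc 0 (n * δ), ‖T t‖ ≤ N := by
    intro n
    induction n with
    | zero =>
      refine ⟨max 1 M, le_max_left _ _, fun t ht => (hM t ⟨ht.1, ?_⟩).trans (le_max_right _ _)⟩
      have := ht.2
      simp only [Nat.cast_zero, zero_mul] at this
      exact this.trans hδ.le
    | succ n ih =>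
      obtain ⟨N, hN1, hN⟩ := ih
      refine ⟨max N (M * N), hN1.trans (le_max_left _ _), fun t ht => ?_⟩
      have hM0 : 0 ≤ M := (norm_nonneg _).trans (hM 0 ⟨le_rfl, hδ.le⟩)
      rcases le_total t (n * δ) with h | h
      · exact (hN t ⟨ht.1, h⟩).trans (le_max_left _ _)
      · have hnδ : 0 ≤ (n : ℝ) * δ := by positivity
        have h2 := ht.2
        push_cast at h2
        have : T t = (T (t - n * δ)).comp (T (n * δ)) := by
          rw [← T.map_add _ _ (by linarith) hnδ, sub_add_cancel]
        rw [this]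
        refine (ContinuousLinearMap.opNorm_comp_le _ _).trans (le_trans ?_ (le_max_right _ _))
        exact mul_le_mul (hM _ ⟨by linarith, by linarith⟩) (hN _ ⟨hnδ, le_rfl⟩) (norm_nonneg _) hM0
  obtain ⟨n, hn⟩ := exists_nat_ge (τ / δ)
  obtain ⟨N, hN1, hN⟩ := key n
  exact ⟨N, hN1, fun t ht => hN t ⟨ht.1, ht.2.trans ((div_le_iff₀ hδ).1 hn)⟩⟩

/-- The action `(t, x) ↦ T(t) x` is jointly continuous on `[0, ∞) × X`. -/
theorem continuous_action [CompleteSpace X] (T : C0Semigroup 𝕜 X) :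
    Continuous fun p : ℝ × X => T (max 0 p.1) p.2 := by
  have hTz : ∀ x, Tendsto (fun s => T |s| x) (𝓝 0) (𝓝 x) := fun x => by
    have h0 : Tendsto (fun s => T |s| x) (𝓝[≠] 0) (𝓝 x) :=
      (T.tendsto_zero x).comp (tendsto_nhdsWithin_iff.2
        ⟨(continuous_abs.tendsto' 0 0 abs_zero).mono_left nhdsWithin_le_nhds,
          eventually_nhdsWithin_of_forall fun s hs => abs_pos.2 hs⟩)
    have h1 : ContinuousAt (fun s => T |s| x) 0 :=
      continuousAt_iff_punctured_nhds.2 (by simpa [T.map_zero] using h0)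
    simpa [ContinuousAt, T.map_zero] using h1
  -- Factoring out the operator at the smaller time reduces continuity at any time to continuity at
  -- 0.
  have hdiff : ∀ (x : X) (a b M : ℝ), 0 ≤ a → 0 ≤ b → ‖T a‖ ≤ M → ‖T b‖ ≤ M →
      ‖T a x - T b x‖ ≤ M * ‖T |a - b| x - x‖ := by
    have aux : ∀ (x : X) (a b M : ℝ), 0 ≤ a → a ≤ b → ‖T a‖ ≤ M →
        ‖T b x - T a x‖ ≤ M * ‖T (b - a) x - x‖ := fun x a b M ha hab hM => by
      have : T b x = T a (T (b - a) x) := by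
        rw [← ContinuousLinearMap.comp_apply, ← T.map_add _ _ ha (by linarith), add_sub_cancel]
      rw [this, ← map_sub]
      exact (T a).le_of_opNorm_le hM _
    intro x a b M ha hb hMa hMb
    rcases le_total a b with h | h
    · rw [norm_sub_rev, abs_sub_comm, abs_of_nonneg (by linarith)]
      exact aux x a b M ha h hMa
    · rw [abs_of_nonneg (by linarith)]
      exact aux x b a M hb h hMb
  refine continuous_iff_continuousAt.2 fun ⟨t₀, x₀⟩ => ?_
  obtain ⟨M, hM1, hM⟩ := T.exists_bound (max 0 t₀ + 1)
  have hmax : Tendsto (fun p : ℝ × X => max 0 p.1) (𝓝 (t₀, x₀)) (𝓝 (max 0 t₀)) :=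
    Continuous.tendsto' (by fun_prop) _ _ rfl
  rw [ContinuousAt, tendsto_iff_norm_sub_tendsto_zero]
  have hlim : Tendsto (fun p : ℝ × X => M * ‖p.2 - x₀‖ +
      M * ‖T |max 0 p.1 - max 0 t₀| x₀ - x₀‖) (𝓝 (t₀, x₀)) (𝓝 0) := by
    have h1 : Tendsto (fun p : ℝ × X => M * ‖p.2 - x₀‖) (𝓝 (t₀, x₀)) (𝓝 0) :=
      Continuous.tendsto' (by fun_prop) _ _ (by simp)
    have h2 : Tendsto (fun p : ℝ × X => T |max 0 p.1 - max 0 t₀| x₀) (𝓝 (t₀, x₀)) (𝓝 x₀) := by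
      refine (hTz x₀).comp (f := fun p : ℝ × X => max 0 p.1 - max 0 t₀) ?_
      simpa using hmax.sub_const (max 0 t₀)
    have h3 := ((h2.sub_const x₀).norm).const_mul M
    simpa using h1.add h3
  refine squeeze_zero' (Eventually.of_forall fun _ => norm_nonneg _) ?_ hlim
  filter_upwards [hmax.eventually (eventually_le_nhds (lt_add_one _))] with p hp
  have hTp := hM (max 0 p.1) ⟨le_max_left _ _, hp⟩
  calc ‖T (max 0 p.1) p.2 - T (max 0 t₀) x₀‖
      = ‖T (max 0 p.1) (p.2 - x₀) + (T (max 0 p.1) x₀ - T (max 0 t₀) x₀)‖ := by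
        rw [map_sub]; congr 1; abel
    _ ≤ _ := (norm_add_le _ _).trans (add_le_add ((T _).le_of_opNorm_le hTp _)
        (hdiff x₀ _ _ M (le_max_left _ _) (le_max_left _ _) hTp
          (hM _ ⟨le_max_left _ _, by linarith⟩)))

theorem continuous_orbit [CompleteSpace X] (T : C0Semigroup 𝕜 X) (x : X) :
    Continuous fun t : ℝ => T (max 0 t) x :=
  T.continuous_action.comp (by fun_prop : Continuous fun t : ℝ => (t, x))

theorem apply_add (T : C0Semigroup 𝕜 X) {s t : ℝ} (hs : 0 ≤ s) (ht : 0 ≤ t) (x : X) :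
    T (s + t) x = T s (T t x) := by
  rw [T.map_add s t hs ht, ContinuousLinearMap.comp_apply]

/-- `D(A)` is invariant under the semigroup, and `A T(t) = T(t) A` on `D(A)`. -/
theorem HasGeneratorAt.apply {T : C0Semigroup 𝕜 X} {x y : X} (h : T.HasGeneratorAt x y)
    {t : ℝ} (ht : 0 ≤ t) : T.HasGeneratorAt (T t x) (T t y) := by
  refine (((T t).continuous.tendsto y).comp h).congr' ?_
  filter_upwards [self_mem_nhdsWithin] with s hs
  have hs : 0 ≤ s := le_of_lt hs
  simp only [Function.comp_apply, map_smul, map_sub]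
  rw [← T.apply_add ht hs, ← T.apply_add hs ht, add_comm]

variable [NormedSpace ℝ X] [IsScalarTower ℝ 𝕜 X]

theorem hasGeneratorAt_iff_real (T : C0Semigroup 𝕜 X) (x y : X) :
    T.HasGeneratorAt x y ↔ Tendsto (fun t : ℝ => t⁻¹ • (T t x - x)) (𝓝[>] 0) (𝓝 y) := by
  simp only [HasGeneratorAt, RCLike.real_smul_eq_coe_smul (K := 𝕜)]

/-- Only right derivatives are needed: the fundamental theorem of calculus and the comparison lemmas
used below accept them. -/
theorem HasGeneratorAt.hasDerivWithinAt {T : C0Semigroup 𝕜 X} {x y : X}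
    (h : T.HasGeneratorAt x y) {t : ℝ} (ht : 0 ≤ t) :
    HasDerivWithinAt (fun s => T (max 0 s) x) (T t y) (Ioi t) t := by
  rw [hasDerivWithinAt_iff_tendsto_slope' (by simp)]
  have h' := (hasGeneratorAt_iff_real _ _ _).1 (h.apply ht)
  have hsub : Tendsto (fun s : ℝ => s - t) (𝓝[>] t) (𝓝[>] 0) :=
    by
    refine tendsto_nhdsWithin_iff.2 ⟨?_, eventually_nhdsWithin_of_forall fun s hs => ?_⟩
    · exact ((continuous_sub_right t).tendsto' t 0 (sub_self t)).mono_left nhdsWithin_le_nhds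
    · exact sub_pos.2 (mem_Ioi.1 hs)
  refine (h'.comp hsub).congr' ?_
  filter_upwards [self_mem_nhdsWithin] with s hs
  have hs : t < s := hs
  simp only [Function.comp_apply, slope_def_module]
  rw [← T.apply_add (by linarith) ht, sub_add_cancel, max_eq_right ht,
    max_eq_right (ht.trans hs.le)]

/-- The averages h⁻¹ ∫₀ʰ T(s)x ds converge to x as h → 0+ and lie in D(A), since A maps ∫₀ʰ T(s)x ds
to T(h)x - x. -/
theorem dense_domain [CompleteSpace X] (T : C0Semigroup 𝕜 X) : Dense (T.domain : Set X) := by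
  intro x
  set c : ℝ → X := fun s => T (max 0 s) x with hc
  have hcc : Continuous c := T.continuous_orbit x
  have hI : ∀ a b, IntervalIntegrable c MeasureTheory.volume a b :=
    fun a b => hcc.intervalIntegrable a b
  have hF : ∀ r, HasDerivAt (fun r => ∫ s in (0 : ℝ)..r, c s) (c r) r :=
    fun r => (hcc.integral_hasStrictDerivAt 0 r).hasDerivAt
  have hslope : ∀ r, Tendsto (fun t : ℝ => t⁻¹ • ((∫ s in (0 : ℝ)..(r + t), c s) -
      ∫ s in (0 : ℝ)..r, c s)) (𝓝[>] 0) (𝓝 (c r)) := fun r =>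
    ((hasDerivAt_iff_tendsto_slope_zero.1 (hF r)).mono_left
      (nhdsWithin_mono _ fun s hs => ne_of_gt hs))
  have hmem : ∀ h : ℝ, 0 ≤ h → (∫ s in (0 : ℝ)..h, c s) ∈ T.domain := fun h hh => by
    refine ⟨c h - c 0, (hasGeneratorAt_iff_real _ _ _).2 ?_⟩
    refine ((hslope h).sub (hslope 0)).congr' ?_
    filter_upwards [self_mem_nhdsWithin] with t ht
    have ht : 0 ≤ t := le_of_lt ht
    have : T t (∫ s in (0 : ℝ)..h, c s) =
        (∫ s in (0 : ℝ)..(h + t), c s) - ∫ s in (0 : ℝ)..t, c s := by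
      rw [← ContinuousLinearMap.intervalIntegral_comp_comm _ (hI 0 h),
        intervalIntegral.integral_interval_sub_left (hI _ _) (hI _ _)]
      have h1 := intervalIntegral.integral_comp_add_right (a := 0) (b := h) c t
      rw [zero_add] at h1
      rw [← h1]
      refine intervalIntegral.integral_congr fun s hs => ?_
      rw [uIcc_of_le hh] at hs
      simp only [hc]
      rw [max_eq_right hs.1, max_eq_right (add_nonneg hs.1 ht), add_comm s t,
        T.apply_add ht hs.1]
    rw [this, ← smul_sub]
    congr 1
    simp only [zero_add, intervalIntegral.integral_same, sub_zero]
    abel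
  have hx : c 0 = x := by simp [hc, T.map_zero]
  have hlim := hslope 0
  rw [hx] at hlim
  simp only [zero_add, intervalIntegral.integral_same, sub_zero] at hlim
  refine mem_closure_of_tendsto hlim ?_
  filter_upwards [self_mem_nhdsWithin] with t ht
  rw [RCLike.real_smul_eq_coe_smul (K := 𝕜)]
  exact T.domain.smul_mem _ (hmem t (le_of_lt ht))

end Banach

/-! ### The Lyapunov equation in integrated form. -/

section Hilbert

variable {𝕜 X : Type*} [RCLike 𝕜] [NormedAddCommGroup X] [InnerProductSpace 𝕜 X]
  [CompleteSpace X] [NormedSpace ℝ X] [IsScalarTower ℝ 𝕜 X]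

theorem lyapunov_integral_of_mem_domain (T : C0Semigroup 𝕜 X) {P : X →L[𝕜] X}
    (hPsa : IsSelfAdjoint P) (hP : SolvesLyapunovEquation T.generator P) {x : X}
    (hx : x ∈ T.domain) {t : ℝ} (ht : 0 ≤ t) :
    RCLike.re (inner 𝕜 (P (T (max 0 t) x)) (T (max 0 t) x)) =
      RCLike.re (inner 𝕜 (P x) x) - ∫ s in (0 : ℝ)..t, ‖T (max 0 s) x‖ ^ 2 := by
  obtain ⟨y, hy⟩ := hx
  have hcont := T.continuous_orbit x
  have hd : ∀ s ∈ Ioo (min 0 t) (max 0 t), HasDerivWithinAt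
      (fun s => RCLike.re (inner 𝕜 (P (T (max 0 s) x)) (T (max 0 s) x)))
      (-‖T (max 0 s) x‖ ^ 2) (Ioi s) s := by
    intro s hs
    rw [min_eq_left ht] at hs
    have hs0 : 0 ≤ s := hs.1.le
    have h1 := hy.hasDerivWithinAt hs0
    have hg := hy.apply hs0
    have hgen : T.generator ⟨T s x, ⟨_, hg⟩⟩ = T s y :=
      tendsto_nhds_unique (T.hasGeneratorAt_generator ⟨T s x, ⟨_, hg⟩⟩) hg
    have hl := hP ⟨T s x, ⟨_, hg⟩⟩
    rw [hgen] at hl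
    have hl' := congrArg RCLike.re hl
    simp only [_root_.map_add, map_neg, RCLike.ofReal_re] at hl'
    have h2 : HasDerivWithinAt (fun s => P (T (max 0 s) x)) (P (T s y)) (Ioi s) s :=
      (P.restrictScalars ℝ).hasFDerivAt.comp_hasDerivWithinAt s h1
    have h3 := (RCLike.reCLM (K := 𝕜)).hasFDerivAt.comp_hasDerivWithinAt s (h2.inner 𝕜 h1)
    refine h3.congr_deriv ?_
    have hsym : inner 𝕜 (P (T s y)) (T s x) = inner 𝕜 (T s y) (P (T s x)) :=
      hPsa.isSymmetric (T s y) (T s x)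
    simp only [RCLike.reCLM_apply, max_eq_right hs0, _root_.map_add, hsym]
    linarith
  have := intervalIntegral.integral_eq_sub_of_hasDeriv_right (a := 0) (b := t)
    (f := fun s => RCLike.re (inner 𝕜 (P (T (max 0 s) x)) (T (max 0 s) x)))
    (f' := fun s => -‖T (max 0 s) x‖ ^ 2) (by fun_prop) hd
    (Continuous.intervalIntegrable (by fun_prop) _ _)
  simp only [intervalIntegral.integral_neg, max_self, T.map_zero,
    ContinuousLinearMap.id_apply] at this
  linarith

/-- The identity on D(A) extends by density, since both sides are continuous in x; A itself no
longer appears in it. -/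
theorem lyapunov_integral (T : C0Semigroup 𝕜 X) {P : X →L[𝕜] X}
    (hPsa : IsSelfAdjoint P) (hP : SolvesLyapunovEquation T.generator P) (x : X)
    {t : ℝ} (ht : 0 ≤ t) :
    RCLike.re (inner 𝕜 (P (T (max 0 t) x)) (T (max 0 t) x)) =
      RCLike.re (inner 𝕜 (P x) x) - ∫ s in (0 : ℝ)..t, ‖T (max 0 s) x‖ ^ 2 := by
  have hclosed : IsClosed {x : X | RCLike.re (inner 𝕜 (P (T (max 0 t) x)) (T (max 0 t) x)) =
      RCLike.re (inner 𝕜 (P x) x) - ∫ s in (0 : ℝ)..t, ‖T (max 0 s) x‖ ^ 2} := by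
    refine isClosed_eq (by fun_prop) (Continuous.sub (by fun_prop) ?_)
    refine intervalIntegral.continuous_parametric_intervalIntegral_of_continuous
      (f := fun x s => ‖T (max 0 s) x‖ ^ 2) ?_ continuous_const
    exact ((T.continuous_action.comp continuous_swap).norm.pow 2)
  have := closure_minimal (s := (T.domain : Set X))
    (fun z hz => T.lyapunov_integral_of_mem_domain hPsa hP hz ht) hclosed
  exact this (T.dense_domain x)

end Hilbert

/-! ### Mild solutions of the inhomogeneous linear equation. -/

section Mild

variable {𝕜 X : Type*} [RCLike 𝕜] [NormedAddCommGroup X] [NormedSpace 𝕜 X]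

theorem continuous_convolution_integrand [CompleteSpace X] (T : C0Semigroup 𝕜 X) {g : ℝ → X}
    (hg : Continuous g) :
    Continuous (Function.uncurry fun t s : ℝ => T (max 0 (t - s)) (g s)) :=
  T.continuous_action.comp (by fun_prop : Continuous fun p : ℝ × ℝ => (p.1 - p.2, g p.2))

variable [NormedSpace ℝ X]

/-- The mild solution `T(t) x₀ + ∫₀ᵗ T(t - s) g(s) ds` of `x' = A x + g`, `x(0) = x₀`. -/
noncomputable def mild (T : C0Semigroup 𝕜 X) (x₀ : X) (g : ℝ → X) (t : ℝ) : X :=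
  T (max 0 t) x₀ + ∫ s in (0 : ℝ)..t, T (max 0 (t - s)) (g s)

theorem mild_zero (T : C0Semigroup 𝕜 X) (x₀ : X) (g : ℝ → X) : T.mild x₀ g 0 = x₀ := by
  simp [mild, T.map_zero]

theorem mild_eq (T : C0Semigroup 𝕜 X) (x₀ : X) (g : ℝ → X) {t : ℝ} (ht : 0 ≤ t) :
    T.mild x₀ g t = T t x₀ + ∫ s in (0 : ℝ)..t, T (t - s) (g s) := by
  rw [mild, max_eq_right ht]
  congr 1
  refine intervalIntegral.integral_congr fun s hs => ?_
  rw [uIcc_of_le ht] at hs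
  simp only [max_eq_right (sub_nonneg.2 hs.2)]

theorem continuous_mild [CompleteSpace X] (T : C0Semigroup 𝕜 X) (x₀ : X) {g : ℝ → X}
    (hg : Continuous g) :
    Continuous (T.mild x₀ g) :=
  (T.continuous_orbit x₀).add
    (intervalIntegral.continuous_parametric_intervalIntegral_of_continuous
      (T.continuous_convolution_integrand hg) continuous_id)

/-- Restarting at time a with shifted forcing reduces derivatives at any time to derivatives at 0.
-/
theorem mild_add [CompleteSpace X] [IsScalarTower ℝ 𝕜 X] (T : C0Semigroup 𝕜 X) (x₀ : X) {g : ℝ → X}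
    (hg : Continuous g) {a h : ℝ} (ha : 0 ≤ a) (hh : 0 ≤ h) :
    T.mild x₀ g (a + h) = T.mild (T.mild x₀ g a) (fun s => g (a + s)) h := by
  have hI : ∀ t b c : ℝ, IntervalIntegrable (fun s => T (max 0 (t - s)) (g s))
      MeasureTheory.volume b c := fun t b c =>
    ((T.continuous_convolution_integrand hg).comp (Continuous.prodMk_right t)).intervalIntegrable b c
  have e1 : (∫ s in (0 : ℝ)..a, T (max 0 (a + h - s)) (g s)) =
      T h (∫ s in (0 : ℝ)..a, T (max 0 (a - s)) (g s)) := by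
    rw [← ContinuousLinearMap.intervalIntegral_comp_comm _ (hI a 0 a)]
    refine intervalIntegral.integral_congr fun s hs => ?_
    rw [uIcc_of_le ha] at hs
    have h1 : 0 ≤ a - s := sub_nonneg.2 hs.2
    rw [max_eq_right h1, ← T.apply_add hh h1, max_eq_right (by linarith)]
    congr 2
    ring
  have e2 : (∫ s in a..(a + h), T (max 0 (a + h - s)) (g s)) =
      ∫ s in (0 : ℝ)..h, T (max 0 (h - s)) (g (a + s)) := by
    have := intervalIntegral.integral_comp_add_left (a := 0) (b := h)
      (fun s => T (max 0 (a + h - s)) (g s)) a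
    rw [add_zero] at this
    rw [← this]
    simp only [add_sub_add_left_eq_sub]
  rw [mild, mild, mild, ← intervalIntegral.integral_add_adjacent_intervals (hI _ 0 a) (hI _ a _),
    e1, e2, max_eq_right ha, max_eq_right hh, max_eq_right (add_nonneg ha hh), _root_.map_add,
    add_comm a h, T.apply_add hh ha, add_assoc]

theorem tendsto_inv_smul_convolution [CompleteSpace X] (T : C0Semigroup 𝕜 X) {g : ℝ → X} (hg : Continuous g) :
    Tendsto (fun h : ℝ => h⁻¹ • ∫ s in (0 : ℝ)..h, T (max 0 (h - s)) (g s)) (𝓝[>] 0)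
      (𝓝 (g 0)) := by
  have hcont := T.continuous_convolution_integrand hg
  rw [Metric.tendsto_nhds]
  intro ε hε
  have h0 := Metric.continuousAt_iff.1 (hcont.continuousAt (x := ((0 : ℝ), (0 : ℝ)))) (ε / 2)
    (by positivity)
  obtain ⟨δ, hδ, H⟩ := h0
  filter_upwards [Ioo_mem_nhdsGT hδ] with h hh
  have hI : IntervalIntegrable (fun s => T (max 0 (h - s)) (g s)) MeasureTheory.volume 0 h :=
    (hcont.comp (Continuous.prodMk_right h)).intervalIntegrable _ _
  have hb : ‖∫ s in (0 : ℝ)..h, (T (max 0 (h - s)) (g s) - g 0)‖ ≤ ε / 2 * |h - 0| := by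
    refine intervalIntegral.norm_integral_le_of_norm_le_const fun s hs => ?_
    rw [uIoc_of_le hh.1.le] at hs
    have := H (x := (h, s)) (by
      rw [Prod.dist_eq]
      simp only [Real.dist_eq, sub_zero, abs_of_pos hh.1, abs_of_pos hs.1]
      exact max_lt hh.2 (hs.2.trans_lt hh.2))
    simp only [Function.uncurry, sub_self, max_self, T.map_zero, ContinuousLinearMap.id_apply,
      dist_eq_norm] at this
    exact this.le
  have hpos : 0 < h := hh.1
  rw [intervalIntegral.integral_sub hI (by simp), intervalIntegral.integral_const, sub_zero,
    abs_of_pos hpos] at hb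
  have e : h⁻¹ • (∫ s in (0 : ℝ)..h, T (max 0 (h - s)) (g s)) - g 0 =
      h⁻¹ • ((∫ s in (0 : ℝ)..h, T (max 0 (h - s)) (g s)) - h • g 0) := by
    rw [smul_sub, inv_smul_smul₀ hpos.ne']
  rw [dist_eq_norm, e, norm_smul, norm_inv, Real.norm_of_nonneg hpos.le]
  calc h⁻¹ * _ ≤ h⁻¹ * (ε / 2 * h) := by gcongr
    _ = ε / 2 := by field_simp
    _ < ε := by linarith

end Mild

/-! ### The right derivative of the energy along mild solutions. -/

section Energy

variable {𝕜 X : Type*} [RCLike 𝕜] [NormedAddCommGroup X] [InnerProductSpace 𝕜 X]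
  [CompleteSpace X] [NormedSpace ℝ X] [IsScalarTower ℝ 𝕜 X]

/-- With Z(h) the convolution term, the increment of Q is -∫₀ʰ ‖T(s)y‖² ds + 2 Re⟨P T(h)y, Z(h)⟩ +
Re⟨P Z(h), Z(h)⟩. After division by h the last term vanishes, because Z(h)/h stays bounded and Z(h)
→ 0. -/
theorem tendsto_energy_quotient (T : C0Semigroup 𝕜 X) {P : X →L[𝕜] X}
    (hPsa : IsSelfAdjoint P) (hP : SolvesLyapunovEquation T.generator P) (y : X) {g : ℝ → X}
    (hg : Continuous g) :
    Tendsto (fun h : ℝ => h⁻¹ * (RCLike.re (inner 𝕜 (P (T.mild y g h)) (T.mild y g h)) -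
      RCLike.re (inner 𝕜 (P y) y))) (𝓝[>] 0)
      (𝓝 (-‖y‖ ^ 2 + 2 * RCLike.re (inner 𝕜 (P y) (g 0)))) := by
  set Z : ℝ → X := fun h => ∫ s in (0 : ℝ)..h, T (max 0 (h - s)) (g s) with hZ
  have hZc : Continuous Z := intervalIntegral.continuous_parametric_intervalIntegral_of_continuous
    (T.continuous_convolution_integrand hg) continuous_id
  have hZ0 : Z 0 = 0 := by simp [hZ]
  have hZlim : Tendsto Z (𝓝[>] 0) (𝓝 0) := (hZc.tendsto' 0 0 hZ0).mono_left nhdsWithin_le_nhds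
  have hZd : Tendsto (fun h : ℝ => h⁻¹ • Z h) (𝓝[>] 0) (𝓝 (g 0)) :=
    T.tendsto_inv_smul_convolution hg
  have hTy : Tendsto (fun h : ℝ => T (max 0 h) y) (𝓝[>] 0) (𝓝 y) :=
    ((T.continuous_orbit y).tendsto' 0 y (by simp [T.map_zero])).mono_left nhdsWithin_le_nhds
  have hcont : Continuous fun s => ‖T (max 0 s) y‖ ^ 2 := (T.continuous_orbit y).norm.pow 2
  have hInt : Tendsto (fun h : ℝ => h⁻¹ * ∫ s in (0 : ℝ)..h, ‖T (max 0 s) y‖ ^ 2) (𝓝[>] 0)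
      (𝓝 (‖y‖ ^ 2)) := by
    have := (hasDerivAt_iff_tendsto_slope_zero.1
      (hcont.integral_hasStrictDerivAt 0 0).hasDerivAt).mono_left
        (nhdsWithin_mono (0 : ℝ) (s := Ioi 0) fun s hs => ne_of_gt hs)
    simpa [T.map_zero] using this
  have hinner : ∀ {F G : ℝ → X} {a b : X}, Tendsto F (𝓝[>] 0) (𝓝 a) → Tendsto G (𝓝[>] 0) (𝓝 b) →
      Tendsto (fun h => RCLike.re (inner 𝕜 (P (F h)) (G h))) (𝓝[>] 0)
        (𝓝 (RCLike.re (inner 𝕜 (P a) b))) := fun hF hG =>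
    (RCLike.continuous_re.tendsto _).comp (((P.continuous.tendsto _).comp hF).inner hG)
  have key := (hInt.neg.add ((hinner hTy hZd).const_mul 2)).add (hinner hZlim hZd)
  simp only [_root_.map_zero, inner_zero_left, add_zero] at key
  refine key.congr' ?_
  filter_upwards [self_mem_nhdsWithin] with h hh
  have hh0 : 0 ≤ h := le_of_lt hh
  have hsmul : ∀ a b : X, RCLike.re (inner 𝕜 (P a) (h⁻¹ • b)) =
      h⁻¹ * RCLike.re (inner 𝕜 (P a) b) := fun a b => by
    rw [RCLike.real_smul_eq_coe_smul (K := 𝕜), inner_smul_right, RCLike.re_ofReal_mul]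
  have hsym : RCLike.re (inner 𝕜 (P (Z h)) (T (max 0 h) y)) =
      RCLike.re (inner 𝕜 (P (T (max 0 h) y)) (Z h)) := by
    rw [inner_re_symm]
    exact congrArg RCLike.re (hPsa.isSymmetric (T (max 0 h) y) (Z h)).symm
  have hm : T.mild y g h = T (max 0 h) y + Z h := rfl
  rw [hm, _root_.map_add, inner_add_left, inner_add_right, inner_add_right, _root_.map_add,
    _root_.map_add, _root_.map_add, T.lyapunov_integral hPsa hP y hh0, hsmul, hsmul, hsym]
  ring

/-- Along mild solutions `⟨Px, x⟩` has the right derivative `-‖x‖² + 2 Re ⟨Px, g⟩`. -/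
theorem hasDerivWithinAt_energy (T : C0Semigroup 𝕜 X) {P : X →L[𝕜] X}
    (hPsa : IsSelfAdjoint P) (hP : SolvesLyapunovEquation T.generator P) (x₀ : X) {g : ℝ → X}
    (hg : Continuous g) {t : ℝ} (ht : 0 ≤ t) :
    HasDerivWithinAt (fun s => RCLike.re (inner 𝕜 (P (T.mild x₀ g s)) (T.mild x₀ g s)))
      (-‖T.mild x₀ g t‖ ^ 2 + 2 * RCLike.re (inner 𝕜 (P (T.mild x₀ g t)) (g t))) (Ici t) t := by
  rw [← hasDerivWithinAt_Ioi_iff_Ici, hasDerivWithinAt_iff_tendsto_slope' (by simp)]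
  have h := T.tendsto_energy_quotient hPsa hP (T.mild x₀ g t)
    (g := fun s => g (t + s)) (by fun_prop)
  rw [add_zero] at h
  have hsub : Tendsto (fun s : ℝ => s - t) (𝓝[>] t) (𝓝[>] 0) := by
    refine tendsto_nhdsWithin_iff.2 ⟨?_, eventually_nhdsWithin_of_forall fun s hs => ?_⟩
    · exact ((continuous_sub_right t).tendsto' t 0 (sub_self t)).mono_left nhdsWithin_le_nhds
    · exact sub_pos.2 (mem_Ioi.1 hs)
  refine (h.comp hsub).congr' ?_
  filter_upwards [self_mem_nhdsWithin] with s hs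
  have hs : t < s := hs
  simp only [Function.comp_apply, slope_def_module, smul_eq_mul]
  rw [← T.mild_add x₀ hg ht (sub_nonneg.2 hs.le), add_sub_cancel]

end Energy

end C0Semigroup

/-- Gronwall's inequality in integral form. -/
theorem le_exp_of_le_integral {d : ℝ → ℝ} (hd : Continuous d) {a L τ : ℝ} (hL : 0 ≤ L)
    (h : ∀ t ∈ Icc 0 τ, d t ≤ a + L * ∫ s in (0 : ℝ)..t, d s) :
    ∀ t ∈ Icc 0 τ, d t ≤ a * Real.exp (L * t) := by
  have hder : ∀ t : ℝ, HasDerivAt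
      (fun t => Real.exp (-(L * t)) * (a + L * ∫ s in (0 : ℝ)..t, d s))
      (Real.exp (-(L * t)) * L * (d t - (a + L * ∫ s in (0 : ℝ)..t, d s))) t := fun t => by
    have h1 : HasDerivAt (fun t : ℝ => Real.exp (-(L * t))) (Real.exp (-(L * t)) * -(L * 1)) t :=
      ((hasDerivAt_id t).const_mul L).neg.exp
    have h2 := ((hd.integral_hasStrictDerivAt 0 t).hasDerivAt.const_mul L).const_add a
    exact (h1.mul h2).congr_deriv (by ring)
  intro t ht
  have hle := image_le_of_deriv_right_le_deriv_boundary (a := 0) (b := τ) (B := fun _ => a)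
    (B' := fun _ => 0) (fun t _ => (hder t).continuousAt.continuousWithinAt)
    (fun t _ => (hder t).hasDerivWithinAt) (by simp) continuousOn_const
    (fun t _ => hasDerivWithinAt_const _ _ _)
    (fun t ht => mul_nonpos_of_nonneg_of_nonpos (by positivity)
      (sub_nonpos.2 (h t ⟨ht.1, ht.2.le⟩))) ht
  simp only [Real.exp_neg] at hle
  rw [inv_mul_le_iff₀ (Real.exp_pos _)] at hle
  exact ((h t ht).trans hle).trans_eq (mul_comm _ _)

/-! ### Radial truncation. -/

section Truncation

variable {X : Type*} [NormedAddCommGroup X] [NormedSpace ℝ X]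

/-- The radial retraction onto the closed ball of radius `R`. -/
noncomputable def radialRetraction (R : ℝ) (x : X) : X := (R / max R ‖x‖) • x

theorem radialRetraction_of_norm_le {R : ℝ} (hR : 0 < R) {x : X} (hx : ‖x‖ ≤ R) :
    radialRetraction R x = x := by
  rw [radialRetraction, max_eq_left hx, div_self hR.ne', one_smul]

theorem norm_radialRetraction_le_norm {R : ℝ} (hR : 0 < R) (x : X) :
    ‖radialRetraction R x‖ ≤ ‖x‖ := by
  have hm : 0 < max R ‖x‖ := hR.trans_le (le_max_left _ _)
  rw [radialRetraction, norm_smul, Real.norm_of_nonneg (by positivity)]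
  exact mul_le_of_le_one_left (norm_nonneg _) ((div_le_one hm).2 (le_max_left _ _))

theorem norm_radialRetraction_le {R : ℝ} (hR : 0 < R) (x : X) : ‖radialRetraction R x‖ ≤ R := by
  have hm : 0 < max R ‖x‖ := hR.trans_le (le_max_left _ _)
  rw [radialRetraction, norm_smul, Real.norm_of_nonneg (by positivity), div_mul_eq_mul_div,
    div_le_iff₀ hm]
  exact mul_le_mul_of_nonneg_left (le_max_right _ _) hR.le

/-- Changing the vector and changing the scaling factor each cost at most ‖x - y‖. The constant 2
works in any normed space. -/
theorem norm_radialRetraction_sub_le {R : ℝ} (hR : 0 < R) (x y : X) :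
    ‖radialRetraction R x - radialRetraction R y‖ ≤ 2 * ‖x - y‖ := by
  have hm : 0 < max R ‖x‖ := hR.trans_le (le_max_left _ _)
  have hn : 0 < max R ‖y‖ := hR.trans_le (le_max_left _ _)
  have hmn : |max R ‖y‖ - max R ‖x‖| ≤ ‖x - y‖ := by
    rw [abs_sub_comm]
    exact (abs_max_sub_max_le_max R ‖x‖ R ‖y‖).trans
      (by simpa using abs_norm_sub_norm_le x y)
  have e : radialRetraction R x - radialRetraction R y =
      (R / max R ‖x‖) • (x - y) + (R / max R ‖x‖ - R / max R ‖y‖) • y := by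
    rw [radialRetraction, radialRetraction, smul_sub, sub_smul]; abel
  have h1 : ‖(R / max R ‖x‖) • (x - y)‖ ≤ ‖x - y‖ := by
    rw [norm_smul, Real.norm_of_nonneg (by positivity)]
    exact mul_le_of_le_one_left (norm_nonneg _) ((div_le_one hm).2 (le_max_left _ _))
  have h2 : ‖(R / max R ‖x‖ - R / max R ‖y‖) • y‖ ≤ ‖x - y‖ := by
    have e2 : R / max R ‖x‖ - R / max R ‖y‖ =
        (R / max R ‖x‖) * ((max R ‖y‖ - max R ‖x‖) / max R ‖y‖) := by
      field_simp
    rw [norm_smul, e2, norm_mul, norm_div (max R ‖y‖ - max R ‖x‖),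
      Real.norm_of_nonneg (by positivity : 0 ≤ R / max R ‖x‖), Real.norm_of_nonneg hn.le,
      Real.norm_eq_abs, mul_assoc]
    have h3 : |max R ‖y‖ - max R ‖x‖| / max R ‖y‖ * ‖y‖ ≤ |max R ‖y‖ - max R ‖x‖| := by
      rw [div_mul_eq_mul_div, div_le_iff₀ hn]
      exact mul_le_mul_of_nonneg_left (le_max_right _ _) (abs_nonneg _)
    exact (mul_le_of_le_one_left (by positivity) ((div_le_one hm).2 (le_max_left _ _))).trans
      (h3.trans hmn)
  rw [e]
  linarith [norm_add_le ((R / max R ‖x‖) • (x - y)) ((R / max R ‖x‖ - R / max R ‖y‖) • y)]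

end Truncation

/-! ### Estimates for mild solutions and the globally Lipschitz equation. -/

section MildEstimates

variable {𝕜 X : Type*} [RCLike 𝕜] [NormedAddCommGroup X] [NormedSpace 𝕜 X]
  [NormedSpace ℝ X]

theorem C0Semigroup.norm_mild_le (T : C0Semigroup 𝕜 X) {M τ : ℝ}
    (hM : ∀ t ∈ Icc 0 τ, ‖T t‖ ≤ M) (x₀ : X) {g : ℝ → X} {γ : ℝ → ℝ} (hγ : Continuous γ) {t : ℝ}
    (ht : t ∈ Icc 0 τ) (hgγ : ∀ s ∈ Icc 0 t, ‖g s‖ ≤ γ s) :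
    ‖T.mild x₀ g t‖ ≤ M * ‖x₀‖ + M * ∫ s in (0 : ℝ)..t, γ s := by
  have hM0 : 0 ≤ M := (norm_nonneg _).trans (hM t ht)
  rw [mild, max_eq_right ht.1, ← intervalIntegral.integral_const_mul]
  refine (norm_add_le _ _).trans (add_le_add ((T t).le_of_opNorm_le (hM t ht) _) ?_)
  refine intervalIntegral.norm_integral_le_of_norm_le ht.1 (Eventually.of_forall fun s hs => ?_)
    (Continuous.intervalIntegrable (by fun_prop) _ _)
  have h1 : 0 ≤ t - s := sub_nonneg.2 hs.2
  rw [max_eq_right h1]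
  refine ((T (t - s)).le_of_opNorm_le (hM _ ⟨h1, by linarith [hs.1, ht.2]⟩) _).trans ?_
  exact mul_le_mul_of_nonneg_left (hgγ s ⟨hs.1.le, hs.2⟩) hM0

variable [CompleteSpace X]

theorem C0Semigroup.mild_sub_mild (T : C0Semigroup 𝕜 X) (x₀ : X) {g g' : ℝ → X}
    (hg : Continuous g) (hg' : Continuous g') (t : ℝ) :
    T.mild x₀ g t - T.mild x₀ g' t = T.mild 0 (fun s => g s - g' s) t := by
  have hI : ∀ {g : ℝ → X}, Continuous g →
      IntervalIntegrable (fun s => T (max 0 (t - s)) (g s)) MeasureTheory.volume 0 t := fun hg =>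
    ((T.continuous_convolution_integrand hg).comp (Continuous.prodMk_right t)).intervalIntegrable _ _
  simp only [mild, map_sub, _root_.map_zero, zero_add]
  rw [intervalIntegral.integral_sub (hI hg) (hI hg')]
  abel

/-- Global existence on `[0, τ]` for a globally Lipschitz nonlinearity, by a contraction argument
in an exponentially weighted norm. -/
theorem C0Semigroup.exists_mild_of_lipschitz (T : C0Semigroup 𝕜 X) (x₀ : X) {F : ℝ → X → X}
    (hF : Continuous (Function.uncurry F)) {L : ℝ} (hL : 0 ≤ L)
    (hFL : ∀ s x y, ‖F s x - F s y‖ ≤ L * ‖x - y‖) {τ : ℝ} (hτ : 0 ≤ τ) :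
    ∃ x : ℝ → X, Continuous x ∧ ∀ t ∈ Icc 0 τ, x t = T.mild x₀ (fun s => F s (x s)) t := by
  obtain ⟨M, hM1, hM⟩ := T.exists_bound τ
  -- The weight exponent is chosen so that the contraction factor M L / l is at most 1/2.
  set l : ℝ := 2 * (M * L) + 1 with hl
  have hl0 : 0 < l := by positivity
  -- The unknown is z(s) = e^{-ls} x(s), so the ordinary sup norm of z is the weighted norm of x;
  -- `E` recovers x.
  set E : C(Icc 0 τ, X) → ℝ → X := fun z s => Real.exp (l * s) • IccExtend hτ z s with hE
  have hEc : ∀ z, Continuous (E z) := fun z => by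
    have : Continuous (IccExtend hτ z) := z.continuous.Icc_extend'
    fun_prop
  have hGc : ∀ z, Continuous fun s => F s (E z s) := fun z =>
    hF.comp (continuous_id.prodMk (hEc z))
  set Φ : C(Icc 0 τ, X) → C(Icc 0 τ, X) := fun z =>
    ⟨fun t => Real.exp (-(l * t)) • T.mild x₀ (fun s => F s (E z s)) t, by
      have := T.continuous_mild x₀ (hGc z)
      fun_prop⟩ with hΦ
  have hcontr : ContractingWith (1 / 2) Φ := by
    refine ⟨by norm_num, LipschitzWith.of_dist_le_mul fun z w => ?_⟩
    rw [ContinuousMap.dist_le (by positivity)]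
    intro t
    have ht := t.2
    have hbound : ∀ s ∈ Icc 0 (t : ℝ), ‖F s (E z s) - F s (E w s)‖ ≤
        L * dist z w * Real.exp (l * s) := fun s hs => by
      have hsτ : s ∈ Icc 0 τ := ⟨hs.1, hs.2.trans ht.2⟩
      refine (hFL _ _ _).trans ?_
      simp only [hE]
      rw [← smul_sub, norm_smul, Real.norm_of_nonneg (Real.exp_pos _).le,
        IccExtend_of_mem _ _ hsτ, IccExtend_of_mem _ _ hsτ, ← dist_eq_norm]
      have := ContinuousMap.dist_apply_le_dist (f := z) (g := w) ⟨s, hsτ⟩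
      have he := (Real.exp_pos (l * s)).le
      calc L * (Real.exp (l * s) * dist (z ⟨s, hsτ⟩) (w ⟨s, hsτ⟩))
          ≤ L * (Real.exp (l * s) * dist z w) := by gcongr
        _ = _ := by ring
    have hint : ∫ s in (0 : ℝ)..t, L * dist z w * Real.exp (l * s) =
        L * dist z w * (l⁻¹ * (Real.exp (l * t) - 1)) := by
      rw [intervalIntegral.integral_const_mul,
        intervalIntegral.integral_comp_mul_left (fun s => Real.exp s) hl0.ne', integral_exp]
      simp
    have hmain := T.norm_mild_le hM 0 (γ := fun s => L * dist z w * Real.exp (l * s))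
      (by fun_prop) ht hbound
    rw [norm_zero, mul_zero, zero_add, hint, ← T.mild_sub_mild x₀ (hGc z) (hGc w)] at hmain
    have hexp : Real.exp (-(l * t)) * Real.exp (l * t) = 1 := by
      rw [← Real.exp_add]; simp
    simp only [hΦ, ContinuousMap.coe_mk]
    rw [dist_eq_norm, ← smul_sub, norm_smul, Real.norm_of_nonneg (Real.exp_pos _).le]
    have hD : 0 ≤ dist z w := dist_nonneg
    have hML : 0 ≤ M * L := by positivity
    calc Real.exp (-(l * t)) * _
        ≤ Real.exp (-(l * t)) * (M * (L * dist z w * (l⁻¹ * (Real.exp (l * t) - 1)))) := by gcongr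
      _ = M * L * l⁻¹ * dist z w * (Real.exp (-(l * t)) * Real.exp (l * t)
            - Real.exp (-(l * t))) := by ring
      _ ≤ M * L * l⁻¹ * dist z w * 1 := by
          rw [hexp]
          gcongr
          linarith [Real.exp_pos (-(l * t))]
      _ ≤ ((1 / 2 : NNReal) : ℝ) * dist z w := by
          rw [mul_one]
          gcongr
          rw [← div_eq_mul_inv, div_le_iff₀ hl0]
          push_cast
          rw [hl]
          linarith
  obtain ⟨z, hz⟩ : ∃ z, Φ z = z := ⟨_, hcontr.fixedPoint_isFixedPt⟩
  refine ⟨E z, hEc z, fun t ht => ?_⟩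
  have := congrArg (fun w : C(Icc 0 τ, X) => w ⟨t, ht⟩) hz
  simp only [hΦ, ContinuousMap.coe_mk] at this
  simp only [hE] at this ⊢
  rw [IccExtend_of_mem _ _ ht, ← this, smul_smul, ← Real.exp_add]
  simp

end MildEstimates

section Restriction

variable {𝕜 X U : Type*} [RCLike 𝕜] [NormedAddCommGroup X] [NormedSpace 𝕜 X] [NormedSpace ℝ X]
  {f : X → U → X} {T : C0Semigroup 𝕜 X} {x₀ : X} {u : ℝ → U}

theorem IsSolutionOn.mono {τ τ' : ℝ} {x : ℝ → X} (h : IsSolutionOn T f x₀ u τ x) (hτ : τ' ≤ τ) :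
    IsSolutionOn T f x₀ u τ' x :=
  ⟨h.1.mono (Icc_subset_Icc_right hτ), fun t ht => h.2 t ⟨ht.1, ht.2.trans hτ⟩⟩

theorem IsSolutionOn.congr {τ : ℝ} {x y : ℝ → X} (h : IsSolutionOn T f x₀ u τ x)
    (hxy : EqOn y x (Icc 0 τ)) : IsSolutionOn T f x₀ u τ y := by
  refine ⟨h.1.congr hxy, fun t ht => ?_⟩
  rw [hxy ht, h.2 t ht]
  congr 1
  refine intervalIntegral.integral_congr fun s hs => ?_
  rw [uIcc_of_le ht.1] at hs
  simp only [hxy ⟨hs.1, hs.2.trans ht.2⟩]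

end Restriction

/-! ### Existence and uniqueness for the nonlinear system. -/

section WellPosedness

variable {𝕜 X U : Type*} [RCLike 𝕜] [NormedAddCommGroup X] [NormedSpace 𝕜 X]
  [NormedAddCommGroup U] {f : X → U → X}

theorem NonlinearityAssumption.continuous_uncurry (hf : NonlinearityAssumption f) :
    Continuous (Function.uncurry f) := by
  refine continuous_iff_continuousAt.2 fun ⟨x₀, v₀⟩ => ?_
  obtain ⟨L, hL, hLip⟩ := hf.lipschitz (‖x₀‖ + 1) (by positivity)
  rw [ContinuousAt, tendsto_iff_norm_sub_tendsto_zero]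
  have hlim : Tendsto (fun p : X × U => L * ‖p.1 - x₀‖ + ‖f x₀ p.2 - f x₀ v₀‖) (𝓝 (x₀, v₀))
      (𝓝 0) := by
    have := hf.continuous x₀
    exact Continuous.tendsto' (by fun_prop) _ _ (by simp)
  refine squeeze_zero' (Eventually.of_forall fun _ => norm_nonneg _) ?_ hlim
  have hn : Tendsto (fun p : X × U => ‖p.1‖) (𝓝 (x₀, v₀)) (𝓝 ‖x₀‖) :=
    Continuous.tendsto' (by fun_prop) _ _ rfl
  filter_upwards [hn.eventually (eventually_le_nhds (lt_add_one _))] with p hp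
  have h1 := hLip x₀ p.1 (by linarith) hp p.2
  simp only [Function.uncurry]
  calc ‖f p.1 p.2 - f x₀ v₀‖ ≤ ‖f p.1 p.2 - f x₀ p.2‖ + ‖f x₀ p.2 - f x₀ v₀‖ :=
        norm_sub_le_norm_sub_add_norm_sub _ _ _
    _ ≤ _ := by gcongr

variable [NormedSpace ℝ X] {T : C0Semigroup 𝕜 X} {x₀ : X} {u : ℝ → U}

/-- A solution of the nonlinear system is a mild solution with a continuous forcing term. -/
theorem IsSolutionOn.exists_mild (hf : NonlinearityAssumption f) (hu : IsInput u) {τ : ℝ}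
    (hτ : 0 ≤ τ) {x : ℝ → X} (h : IsSolutionOn T f x₀ u τ x) :
    ∃ g : ℝ → X, Continuous g ∧ (∀ s ∈ Icc 0 τ, g s = f (x s) (u s)) ∧
      ∀ t ∈ Icc 0 τ, x t = T.mild x₀ g t := by
  -- Clamping time to [0, τ] turns the forcing into a continuous function on ℝ without changing it
  -- on the interval.
  have hp : Continuous fun s : ℝ => ((projIcc 0 τ hτ s : Icc 0 τ) : ℝ) :=
    continuous_subtype_val.comp continuous_projIcc
  have hx : Continuous fun s : ℝ => x (projIcc 0 τ hτ s) :=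
    h.1.comp_continuous hp fun s => (projIcc 0 τ hτ s).2
  have hu' : Continuous fun s : ℝ => u (projIcc 0 τ hτ s) :=
    ContinuousOn.comp_continuous hu hp fun s => (projIcc 0 τ hτ s).2.1
  have hg : ∀ s ∈ Icc 0 τ, f (x (projIcc 0 τ hτ s)) (u (projIcc 0 τ hτ s)) = f (x s) (u s) :=
    fun s hs => by rw [projIcc_of_mem hτ hs]
  refine ⟨fun s => f (x (projIcc 0 τ hτ s)) (u (projIcc 0 τ hτ s)),
    hf.continuous_uncurry.comp (hx.prodMk hu'), hg, fun t ht => ?_⟩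
  rw [h.2 t ht, T.mild_eq x₀ _ ht.1]
  congr 1
  refine intervalIntegral.integral_congr fun s hs => ?_
  rw [uIcc_of_le ht.1] at hs
  simp only [hg s ⟨hs.1, hs.2.trans ht.2⟩]

variable [CompleteSpace X]

/-- Both solutions are bounded on the compact interval, so one Lipschitz constant serves both, and
Gronwall with initial value 0 applies. -/
theorem IsSolutionOn.eqOn (hf : NonlinearityAssumption f) (hu : IsInput u) {τ : ℝ}
    {x y : ℝ → X} (hx : IsSolutionOn T f x₀ u τ x) (hy : IsSolutionOn T f x₀ u τ y) :
    EqOn x y (Icc 0 τ) := by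
  intro t ht
  have hτ : 0 ≤ τ := ht.1.trans ht.2
  obtain ⟨M, hM1, hM⟩ := T.exists_bound τ
  obtain ⟨gx, hgx, hgx', hxm⟩ := hx.exists_mild hf hu hτ
  obtain ⟨gy, hgy, hgy', hym⟩ := hy.exists_mild hf hu hτ
  obtain ⟨wx, hwx⟩ := isCompact_Icc.exists_bound_of_continuousOn hx.1
  obtain ⟨wy, hwy⟩ := isCompact_Icc.exists_bound_of_continuousOn hy.1
  obtain ⟨L, hL, hLip⟩ := hf.lipschitz (max 1 (max wx wy)) (by positivity)
  have hd : Continuous fun s => ‖T.mild x₀ gx s - T.mild x₀ gy s‖ :=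
    ((T.continuous_mild x₀ hgx).sub (T.continuous_mild x₀ hgy)).norm
  have hg : ∀ s ∈ Icc 0 τ, ‖gx s - gy s‖ ≤ L * ‖T.mild x₀ gx s - T.mild x₀ gy s‖ := fun s hs => by
    rw [hgx' s hs, hgy' s hs, ← hxm s hs, ← hym s hs]
    exact hLip _ _ ((hwy s hs).trans (by simp)) ((hwx s hs).trans (by simp)) _
  have := le_exp_of_le_integral hd (a := 0) (L := M * L) (τ := τ) (by positivity) (fun t ht => by
    have h1 := T.norm_mild_le hM 0
      (γ := fun s => L * ‖T.mild x₀ gx s - T.mild x₀ gy s‖) (by fun_prop) ht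
      fun s hs => hg s ⟨hs.1, hs.2.trans ht.2⟩
    rw [← T.mild_sub_mild x₀ hgx hgy, intervalIntegral.integral_const_mul] at h1
    simp only [norm_zero, mul_zero] at h1
    rw [mul_assoc]
    exact h1) t ht
  rw [zero_mul, norm_le_zero_iff, sub_eq_zero, ← hxm t ht, ← hym t ht] at this
  exact this

theorem exists_isSolutionOn (hf : NonlinearityAssumption f)
    (hgrowth : ∀ c : ℝ, ∃ b : ℝ, 0 ≤ b ∧ ∀ x v, ‖v‖ ≤ c → ‖f x v‖ ≤ b * (1 + ‖x‖))
    (T : C0Semigroup 𝕜 X) (x₀ : X) (hu : IsInput u) {τ : ℝ} (hτ : 0 ≤ τ) :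
    ∃ x, IsSolutionOn T f x₀ u τ x := by
  obtain ⟨M, hM1, hM⟩ := T.exists_bound τ
  obtain ⟨c, hc⟩ := isCompact_Icc.exists_bound_of_continuousOn
    (ContinuousOn.mono hu fun s (hs : s ∈ Icc 0 τ) => hs.1)
  obtain ⟨b, hb, hfb⟩ := hgrowth c
  -- This is Gronwall's a priori bound for 1 + ‖x‖. The retraction does not increase norms, so the
  -- bound also holds for the truncated equation, whose solution therefore solves the original one.
  set R : ℝ := (1 + M * ‖x₀‖) * Real.exp (M * b * τ) with hR
  have hR0 : 0 < R := by positivity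
  obtain ⟨L, hL, hLip⟩ := hf.lipschitz R hR0
  have hρ : Continuous (radialRetraction R : X → X) :=
    (LipschitzWith.of_dist_le_mul (K := 2) fun x y => by
      simpa [dist_eq_norm] using norm_radialRetraction_sub_le hR0 x y).continuous
  have hu' : Continuous fun s : ℝ => u (max 0 s) :=
    ContinuousOn.comp_continuous hu (by fun_prop) fun s => mem_Ici.2 (le_max_left 0 s)
  have hFc : Continuous (Function.uncurry fun (s : ℝ) (x : X) =>
      f (radialRetraction R x) (u (max 0 s))) :=
    hf.continuous_uncurry.comp ((hρ.comp continuous_snd).prodMk (hu'.comp continuous_fst))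
  obtain ⟨x, hxc, hx⟩ := T.exists_mild_of_lipschitz x₀ hFc (L := L * 2) (by positivity)
    (fun s x y => (hLip _ _ (norm_radialRetraction_le hR0 y) (norm_radialRetraction_le hR0 x)
      _).trans (by
        rw [mul_assoc]
        exact mul_le_mul_of_nonneg_left (norm_radialRetraction_sub_le hR0 x y) hL.le)) hτ
  have hxR : ∀ t ∈ Icc 0 τ, ‖x t‖ ≤ R := fun t ht => by
    have h1 := le_exp_of_le_integral (d := fun s => 1 + ‖x s‖) (by fun_prop)
      (a := 1 + M * ‖x₀‖) (L := M * b) (τ := τ) (by positivity) (fun t ht => by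
        have h2 := T.norm_mild_le hM x₀ (g := fun s => f (radialRetraction R (x s)) (u (max 0 s)))
          (γ := fun s => b * (1 + ‖x s‖)) (by fun_prop) ht fun s hs => by
            refine (hfb _ _ ?_).trans (mul_le_mul_of_nonneg_left
              (add_le_add_right (norm_radialRetraction_le_norm hR0 _) _) hb)
            rw [max_eq_right hs.1]
            exact hc s ⟨hs.1, hs.2.trans ht.2⟩
        rw [← hx t ht, intervalIntegral.integral_const_mul, ← mul_assoc] at h2
        linarith) t ht
    have h3 : (1 + M * ‖x₀‖) * Real.exp (M * b * t) ≤ R := by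
      rw [hR]
      gcongr
      exact ht.2
    linarith
  refine ⟨x, hxc.continuousOn, fun t ht => ?_⟩
  rw [hx t ht, T.mild_eq x₀ _ ht.1]
  congr 1
  refine intervalIntegral.integral_congr fun s hs => ?_
  rw [uIcc_of_le ht.1] at hs
  have hs' : s ∈ Icc 0 τ := ⟨hs.1, hs.2.trans ht.2⟩
  simp only [max_eq_right hs.1, radialRetraction_of_norm_le hR0 (hxR s hs')]

/-- Well-posedness for nonlinearities of at most linear growth. -/
theorem hasTransitionMap_of_linear_growth (hf : NonlinearityAssumption f)
    (hgrowth : ∀ c : ℝ, ∃ b : ℝ, 0 ≤ b ∧ ∀ x v, ‖v‖ ≤ c → ‖f x v‖ ≤ b * (1 + ‖x‖))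
    (T : C0Semigroup 𝕜 X) : HasTransitionMap T f := by
  intro x₀ u hu
  choose z hz using fun n : ℕ => exists_isSolutionOn hf hgrowth T x₀ hu n.cast_nonneg
  -- By uniqueness the solutions on [0, n] are compatible and glue to t ↦ `z ⌈t⌉₊ t`.
  have hagree : ∀ (n : ℕ) (t : ℝ), t ∈ Icc (0 : ℝ) n → z ⌈t⌉₊ t = z n t := fun n t ht =>
    ((hz ⌈t⌉₊).mono (Nat.le_ceil t)).eqOn hf hu ((hz n).mono ht.2) ⟨ht.1, le_rfl⟩
  have hsol : IsSolution T f x₀ u fun t => z ⌈t⌉₊ t := fun τ _ =>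
    ((hz ⌈τ⌉₊).mono (Nat.le_ceil τ)).congr fun t ht =>
      hagree _ t ⟨ht.1, ht.2.trans (Nat.le_ceil τ)⟩
  exact ⟨_, hsol, fun y hy t ht => (hy (t + 1) (by linarith [mem_Ici.1 ht])).eqOn hf hu
    (hsol (t + 1) (by linarith [mem_Ici.1 ht])) ⟨ht, by linarith⟩⟩

end WellPosedness

/-! ### Comparison functions and a differential inequality. -/

section Comparison

theorem ClassK.nonneg {γ : ℝ → ℝ} (hγ : ClassK γ) {r : ℝ} (hr : 0 ≤ r) : 0 ≤ γ r := by
  rcases hr.eq_or_lt with rfl | h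
  · exact hγ.map_zero.ge
  · exact (hγ.pos r h).le

theorem ClassK.mapsTo {γ : ℝ → ℝ} (hγ : ClassK γ) : MapsTo γ (Ici 0) (Ici 0) :=
  fun _ hr => hγ.nonneg hr

theorem classKInfty_of_strictMonoOn {γ : ℝ → ℝ} (hc : ContinuousOn γ (Ici 0)) (h0 : γ 0 = 0)
    (hm : StrictMonoOn γ (Ici 0)) (hu : ∀ M : ℝ, ∃ r, 0 ≤ r ∧ M < γ r) : ClassKInfty γ where
  continuousOn := hc
  map_zero := h0
  pos _ hr := h0 ▸ hm self_mem_Ici hr.le hr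
  strictMonoOn := hm
  unbounded := hu

theorem ClassKInfty.comp {φ γ : ℝ → ℝ} (hφ : ClassKInfty φ) (hγ : ClassKInfty γ) :
    ClassKInfty fun r => φ (γ r) := by
  refine classKInfty_of_strictMonoOn (hφ.continuousOn.comp hγ.continuousOn hγ.mapsTo)
    (by rw [hγ.map_zero, hφ.map_zero]) (hφ.strictMonoOn.comp hγ.strictMonoOn hγ.mapsTo)
    fun M => ?_
  obtain ⟨s, hs, hMs⟩ := hφ.unbounded M
  obtain ⟨r, hr, hsr⟩ := hγ.unbounded s
  exact ⟨r, hr, hMs.trans (hφ.strictMonoOn hs (hγ.mapsTo hr) hsr)⟩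

theorem classKInfty_sqrt : ClassKInfty Real.sqrt :=
  classKInfty_of_strictMonoOn Real.continuous_sqrt.continuousOn Real.sqrt_zero
    (fun _ ha _ _ hab => Real.sqrt_lt_sqrt ha hab)
    fun M => ⟨(|M| + 1) ^ 2, by positivity, by
      rw [Real.sqrt_sq (by positivity)]; linarith [le_abs_self M]⟩

theorem sqrt_add_le_add_sqrt {a b : ℝ} (ha : 0 ≤ a) (hb : 0 ≤ b) :
    Real.sqrt (a + b) ≤ Real.sqrt a + Real.sqrt b := by
  refine Real.sqrt_le_iff.2 ⟨by positivity, ?_⟩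
  nlinarith [Real.sq_sqrt ha, Real.sq_sqrt hb, mul_nonneg (Real.sqrt_nonneg a) (Real.sqrt_nonneg b)]

theorem classKInfty_log_one_add : ClassKInfty fun s => Real.log (1 + s) := by
  refine classKInfty_of_strictMonoOn ?_ (by simp) ?_ fun M => ⟨Real.exp (|M| + 1) - 1, ?_, ?_⟩
  · refine ContinuousOn.log (by fun_prop) fun s hs => ?_
    have := mem_Ici.1 hs
    positivity
  · intro a ha b _ hab
    have := mem_Ici.1 ha
    exact Real.log_lt_log (by positivity) (by linarith)
  · linarith [Real.add_one_le_exp (|M| + 1), abs_nonneg M]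
  · simp only [add_sub_cancel, Real.log_exp]
    linarith [le_abs_self M]

theorem classKInfty_const_mul_sq {k : ℝ} (hk : 0 < k) : ClassKInfty fun r => k * r ^ 2 := by
  refine classKInfty_of_strictMonoOn (by fun_prop) (by simp) (fun a ha b _ hab => ?_)
    fun M => ⟨|M| / k + 1, by positivity, ?_⟩
  · have := mem_Ici.1 ha
    gcongr
  · have h1 : 0 ≤ |M| / k := by positivity
    have h2 : k * (|M| / k) = |M| := by field_simp
    nlinarith [le_abs_self M, mul_nonneg hk.le h1, mul_nonneg hk.le (mul_nonneg h1 h1)]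

/-- A continuous strictly increasing function that dominates a linear one is of class `𝒦_∞`. -/
theorem classKInfty_of_le {γ : ℝ → ℝ} (hc : ContinuousOn γ (Ici 0)) (h0 : γ 0 = 0)
    (hm : StrictMonoOn γ (Ici 0)) {c : ℝ} (hpos : 0 < c) (hle : ∀ r, 0 ≤ r → c * r ≤ γ r) :
    ClassKInfty γ :=
  classKInfty_of_strictMonoOn hc h0 hm fun M => ⟨(|M| + 1) / c, by positivity, by
    have := hle ((|M| + 1) / c) (by positivity)
    rw [mul_div_cancel₀ _ hpos.ne'] at this
    linarith [le_abs_self M]⟩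

theorem classKL_exp_decay {G : ℝ → ℝ} (hG : ClassKInfty G) {p c : ℝ} (hp : 0 < p) (hc : 0 < c) :
    ClassKL fun r t => G (p * r ^ 2 * Real.exp (-(c * t))) := by
  refine ⟨?_, fun t _ => ?_, fun r hr => ⟨fun t _ => ?_, ?_, ?_, ?_⟩⟩
  · refine hG.continuousOn.comp (by fun_prop) fun q _ => ?_
    exact mem_Ici.2 (by positivity)
  · have h := hG.comp (classKInfty_const_mul_sq (mul_pos hp (Real.exp_pos (-(c * t)))))
    simpa only [mul_right_comm] using h.toClassK
  · exact hG.nonneg (by positivity)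
  · refine hG.continuousOn.comp (by fun_prop) fun q _ => ?_
    exact mem_Ici.2 (by positivity)
  · intro a _ b _ hab
    refine hG.strictMonoOn (mem_Ici.2 (by positivity)) (mem_Ici.2 (by positivity)) ?_
    gcongr
  · have h0 : Tendsto G (𝓝[≥] 0) (𝓝 0) := by
      simpa [ContinuousWithinAt, hG.map_zero] using hG.continuousOn 0 self_mem_Ici
    refine h0.comp (tendsto_nhdsWithin_iff.2 ⟨?_, Eventually.of_forall fun t =>
      mem_Ici.2 (by positivity)⟩)
    have h1 : Tendsto (fun t : ℝ => Real.exp (-(c * t))) atTop (𝓝 0) :=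
      Real.tendsto_exp_neg_atTop_nhds_zero.comp (tendsto_id.const_mul_atTop hc)
    simpa using h1.const_mul (p * r ^ 2)

/-- Bounds for a nonnegative function with `q' ≤ -c q + (1 + q) m`. -/
theorem le_of_deriv_right_le {q q' m : ℝ → ℝ} {c t : ℝ} (hc : 0 ≤ c) (ht : 0 ≤ t)
    (hq : Continuous q) (hm : Continuous m) (hm0 : ∀ s, 0 ≤ m s)
    (hd : ∀ s ∈ Ico 0 t, HasDerivWithinAt q (q' s) (Ici s) s)
    (hle : ∀ s ∈ Ico 0 t, q' s ≤ -c * q s + (1 + q s) * m s) :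
    q t ≤ Real.exp (∫ s in (0 : ℝ)..t, m s) *
      (Real.exp (-(c * t)) * q 0 + ∫ s in (0 : ℝ)..t, m s) := by
  set I : ℝ → ℝ := fun t => ∫ s in (0 : ℝ)..t, m s with hI
  have hId : ∀ s, HasDerivAt I (m s) s := fun s => (hm.integral_hasStrictDerivAt 0 s).hasDerivAt
  have hI0 : ∀ s, 0 ≤ s → 0 ≤ I s := fun s hs =>
    intervalIntegral.integral_nonneg hs fun r _ => hm0 r
  have hIc : Continuous I := continuous_iff_continuousAt.2 fun s => (hId s).continuousAt
  have hem : Continuous fun s => Real.exp (c * s) * m s := by fun_prop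
  have hJd : ∀ s, HasDerivAt (fun r => q 0 + ∫ s in (0 : ℝ)..r, Real.exp (c * s) * m s)
      (Real.exp (c * s) * m s) s := fun s =>
    (hem.integral_hasStrictDerivAt 0 s).hasDerivAt.const_add _
  -- The integrating factor e^{cs - I(s)} cancels both terms linear in q and leaves a derivative at
  -- most e^{cs} m(s), as I ≥ 0.
  have hmain := image_le_of_deriv_right_le_deriv_boundary (a := 0) (b := t)
    (f := fun s => Real.exp (c * s - I s) * q s)
    (f' := fun s => Real.exp (c * s - I s) * (c - m s) * q s + Real.exp (c * s - I s) * q' s)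
    (B := fun r => q 0 + ∫ s in (0 : ℝ)..r, Real.exp (c * s) * m s)
    (B' := fun s => Real.exp (c * s) * m s)
    (by fun_prop) (fun s hs => ?_) (by simp [hI])
    (fun s _ => (hJd s).continuousAt.continuousWithinAt)
    (fun s _ => (hJd s).hasDerivWithinAt) (fun s hs => ?_) (right_mem_Icc.2 ht)
  · have hJ : ∫ s in (0 : ℝ)..t, Real.exp (c * s) * m s ≤ Real.exp (c * t) * I t := by
      rw [hI, ← intervalIntegral.integral_const_mul]
      refine intervalIntegral.integral_mono_on ht (hem.intervalIntegrable _ _)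
        (Continuous.intervalIntegrable (by fun_prop) _ _) fun s hs => ?_
      have := hm0 s
      gcongr
      exact hs.2
    have hfin : Real.exp (c * t - I t) * q t ≤ q 0 + Real.exp (c * t) * I t := by
      linarith
    have e1 : Real.exp (I t) * Real.exp (-(c * t)) * Real.exp (c * t - I t) = 1 := by
      rw [← Real.exp_add, ← Real.exp_add]; ring_nf; simp
    have e2 : Real.exp (-(c * t)) * Real.exp (c * t) = 1 := by
      rw [← Real.exp_add]; simp
    calc q t = Real.exp (I t) * Real.exp (-(c * t)) * (Real.exp (c * t - I t) * q t) := by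
          rw [← mul_assoc, e1, one_mul]
      _ ≤ Real.exp (I t) * Real.exp (-(c * t)) * (q 0 + Real.exp (c * t) * I t) := by gcongr
      _ = Real.exp (I t) * (Real.exp (-(c * t)) * q 0 +
            Real.exp (-(c * t)) * Real.exp (c * t) * I t) := by ring
      _ = _ := by rw [e2, one_mul]
  · have h1 : HasDerivAt (fun s => Real.exp (c * s - I s))
        (Real.exp (c * s - I s) * (c * 1 - m s)) s :=
      (((hasDerivAt_id s).const_mul c).sub (hId s)).exp
    exact (h1.hasDerivWithinAt.mul (hd s hs)).congr_deriv (by ring)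
  · have h1 := hle s hs
    have h2 : Real.exp (c * s - I s) ≤ Real.exp (c * s) :=
      Real.exp_le_exp.2 (by linarith [hI0 s hs.1])
    calc Real.exp (c * s - I s) * (c - m s) * q s + Real.exp (c * s - I s) * q' s
        = Real.exp (c * s - I s) * ((c - m s) * q s + q' s) := by ring
      _ ≤ Real.exp (c * s - I s) * m s := by gcongr; linarith
      _ ≤ _ := mul_le_mul_of_nonneg_right h2 (hm0 s)

end Comparison

/-! ### The bilinear system: dissipation, Lyapunov function and iISS. -/

section Bilinear

variable {𝕜 X U : Type*} [RCLike 𝕜] [NormedAddCommGroup X] [InnerProductSpace 𝕜 X]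
  [NormedAddCommGroup U] [NormedSpace 𝕜 U]

theorem bilinearRHS_linear_growth (B : U →L[𝕜] X) {C : X → U → X} {K : ℝ} (hK : 0 < K)
    {ξ : ℝ → ℝ} (hξ : ClassK ξ) (hC : ∀ x v, ‖C x v‖ ≤ K * ‖x‖ * ξ ‖v‖) (c : ℝ) :
    ∃ b : ℝ, 0 ≤ b ∧ ∀ x v, ‖v‖ ≤ c → ‖bilinearRHS B C x v‖ ≤ b * (1 + ‖x‖) := by
  -- The bound c may be negative, whereas ξ is controlled only on [0, ∞).
  have hc0 : 0 ≤ max 0 c := le_max_left _ _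
  have hξc := hξ.nonneg hc0
  refine ⟨‖B‖ * max 0 c + K * ξ (max 0 c), by positivity, fun x v hv => ?_⟩
  have hv' : ‖v‖ ≤ max 0 c := hv.trans (le_max_right _ _)
  have h1 : ‖B v‖ ≤ ‖B‖ * max 0 c := (B.le_opNorm v).trans (by gcongr)
  have h2 : ‖C x v‖ ≤ K * ‖x‖ * ξ (max 0 c) := (hC x v).trans (by
    gcongr
    exact hξ.strictMonoOn.monotoneOn (norm_nonneg v) hc0 hv')
  have h3 : 0 ≤ ‖B‖ * max 0 c * ‖x‖ := by positivity
  have h4 : 0 ≤ K * ξ (max 0 c) := by positivity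
  calc ‖bilinearRHS B C x v‖ ≤ ‖B v‖ + ‖C x v‖ := norm_add_le _ _
    _ ≤ _ := by linarith

/-- The gain `σ(r) = 2 p² ‖B‖² r² + (2 p K / k) ξ(r)` of the bilinear system. -/
noncomputable def bilinearGain (p k K b : ℝ) (ξ : ℝ → ℝ) (r : ℝ) : ℝ :=
  2 * p ^ 2 * b ^ 2 * r ^ 2 + 2 * p * K / k * ξ r

theorem classK_bilinearGain {p k K : ℝ} (hp : 0 < p) (hk : 0 < k) (hK : 0 < K) (b : ℝ)
    {ξ : ℝ → ℝ} (hξ : ClassK ξ) : ClassK (bilinearGain p k K b ξ) := by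
  have hm : StrictMonoOn (bilinearGain p k K b ξ) (Ici 0) := fun r hr s hs hrs => by
    have h1 := hξ.strictMonoOn hr hs hrs
    have h0 := mem_Ici.1 hr
    simp only [bilinearGain]
    have h2 : r ^ 2 ≤ s ^ 2 := by gcongr
    have h3 : 0 < 2 * p * K / k := by positivity
    exact add_lt_add_of_le_of_lt (by gcongr) (by gcongr)
  have h0 : bilinearGain p k K b ξ 0 = 0 := by simp [bilinearGain, hξ.map_zero]
  refine ⟨⟨?_, h0, fun r hr => h0 ▸ hm self_mem_Ici hr.le hr⟩, hm⟩
  have := hξ.continuousOn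
  unfold bilinearGain
  fun_prop

/-- The dissipation inequality for `⟨Px, x⟩`. -/
theorem dissipation_le (B : U →L[𝕜] X) {C : X → U → X} {K : ℝ} {ξ : ℝ → ℝ}
    (hC : ∀ x v, ‖C x v‖ ≤ K * ‖x‖ * ξ ‖v‖) {P : X →L[𝕜] X} {p : ℝ}
    (hp : ‖P‖ ≤ p) (x : X) (v : U) :
    -‖x‖ ^ 2 + 2 * RCLike.re (inner 𝕜 (P x) (bilinearRHS B C x v)) ≤
      -(1 / 2 * ‖x‖ ^ 2) + 2 * p ^ 2 * ‖B‖ ^ 2 * ‖v‖ ^ 2 + 2 * p * K * ‖x‖ ^ 2 * ξ ‖v‖ := by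
  have hp0 : 0 ≤ p := (norm_nonneg P).trans hp
  have h1 : RCLike.re (inner 𝕜 (P x) (bilinearRHS B C x v)) ≤
      p * ‖x‖ * (‖B‖ * ‖v‖ + K * ‖x‖ * ξ ‖v‖) := by
    refine (re_inner_le_norm _ _).trans ?_
    have h2 : ‖bilinearRHS B C x v‖ ≤ ‖B‖ * ‖v‖ + K * ‖x‖ * ξ ‖v‖ :=
      (norm_add_le _ _).trans (add_le_add (B.le_opNorm v) (hC x v))
    exact mul_le_mul (P.le_of_opNorm_le hp x) h2 (norm_nonneg _) (by positivity)
  -- Half of this square is Young's inequality 2p‖x‖‖B‖‖v‖ ≤ ½‖x‖² + 2p²‖B‖²‖v‖².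
  nlinarith [sq_nonneg (‖x‖ - 2 * p * ‖B‖ * ‖v‖)]

theorem re_inner_le_mul_norm_sq {P : X →L[𝕜] X} {p : ℝ} (hp : ‖P‖ ≤ p) (x : X) :
    RCLike.re (inner 𝕜 (P x) x) ≤ p * ‖x‖ ^ 2 := by
  refine (re_inner_le_norm _ _).trans ?_
  rw [pow_two, ← mul_assoc]
  exact mul_le_mul_of_nonneg_right (P.le_of_opNorm_le hp x) (norm_nonneg x)

variable [CompleteSpace X] [NormedSpace ℝ X] [IsScalarTower ℝ 𝕜 X]

/-- `ln(1 + ⟨Px, x⟩)` is an iISS Lyapunov function on every set of states. -/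
theorem isIISSLyapunovFunctionOn_logLyapunov (T : C0Semigroup 𝕜 X) (B : U →L[𝕜] X)
    {C : X → U → X} {K : ℝ} (hK : 0 < K) {ξ : ℝ → ℝ} (hξ : ClassK ξ)
    (hC : ∀ x v, ‖C x v‖ ≤ K * ‖x‖ * ξ ‖v‖) (hf : NonlinearityAssumption (bilinearRHS B C))
    {P : X →L[𝕜] X} (hPsa : IsSelfAdjoint P) (hPcoer : IsCoerciveOperator P)
    (hP : SolvesLyapunovEquation T.generator P) (S : Set X) :
    IsIISSLyapunovFunctionOn T (bilinearRHS B C) S (logLyapunov P) := by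
  obtain ⟨k, hk, hcoer⟩ := hPcoer
  -- Adding 1 keeps p positive even when X is trivial and P = 0.
  set p : ℝ := ‖P‖ + 1 with hp
  have hp0 : 0 < p := by positivity
  have hPp : ‖P‖ ≤ p := by linarith
  have hQ0 : ∀ x, 0 ≤ RCLike.re (inner 𝕜 (P x) x) := fun x =>
    le_trans (by positivity) (hcoer x)
  refine ⟨?_, fun r => Real.log (1 + k * r ^ 2), fun r => Real.log (1 + p * r ^ 2),
    fun r => (1 / 2 * r ^ 2) / (1 + p * r ^ 2), bilinearGain p k K ‖B‖ ξ,
    classKInfty_log_one_add.comp (classKInfty_const_mul_sq hk),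
    classKInfty_log_one_add.comp (classKInfty_const_mul_sq hp0), ⟨?_, by simp, fun r hr => ?_⟩,
    classK_bilinearGain hp0 hk hK ‖B‖ hξ, fun x _ => ⟨?_, ?_⟩, ?_⟩
  · refine Continuous.continuousOn ?_
    unfold logLyapunov
    exact Continuous.log (by fun_prop) fun x => by have := hQ0 x; positivity
  · exact ContinuousOn.div (by fun_prop) (by fun_prop) fun r _ => by positivity
  · positivity
  · exact Real.log_le_log (by positivity) (by linarith [hcoer x])
  · exact Real.log_le_log (by linarith [hQ0 x]) (by linarith [re_inner_le_mul_norm_sq hPp x])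
  · intro x₀ _ u τ x hu hτ hx
    obtain ⟨g, hg, hgx, hxm⟩ := hx.exists_mild hf hu hτ.le
    have hx0 : x 0 = x₀ := by rw [hxm 0 ⟨le_rfl, hτ.le⟩, T.mild_zero]
    have hd := T.hasDerivWithinAt_energy hPsa hP x₀ hg le_rfl
    rw [T.mild_zero, hgx 0 ⟨le_rfl, hτ.le⟩, hx0] at hd
    set Q := RCLike.re (inner 𝕜 (P x₀) x₀) with hQ
    have hQn : 0 ≤ Q := hQ0 x₀
    have hlog := (hd.const_add 1).log (by rw [T.mild_zero]; positivity)
    rw [T.mild_zero, ← hasDerivWithinAt_Ioi_iff_Ici,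
      hasDerivWithinAt_iff_tendsto_slope' (by simp)] at hlog
    have hlim : Tendsto (fun t : ℝ => (1 / t) * (logLyapunov P (x t) - logLyapunov P (x 0)))
        (𝓝[>] 0) (𝓝 ((-‖x₀‖ ^ 2 + 2 * RCLike.re (inner 𝕜 (P x₀) (bilinearRHS B C x₀ (u 0)))) /
          (1 + Q))) := by
      refine hlog.congr' ?_
      filter_upwards [Ioo_mem_nhdsGT hτ] with t ht
      rw [slope_def_module, smul_eq_mul, hxm t ⟨ht.1.le, ht.2.le⟩, hxm 0 ⟨le_rfl, hτ.le⟩,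
        sub_zero, one_div]
      rfl
    -- The Dini quotient has a genuine real limit, so the `EReal` limsup equals it.
    have hlim' := (continuous_coe_real_ereal.tendsto _).comp hlim
    rw [lieDerivative]
    have hls := hlim'.limsup_eq
    simp only [Function.comp_def] at hls
    rw [hls, EReal.coe_le_coe_iff]
    have hdis := dissipation_le B hC hPp x₀ (u 0)
    have hξ0 := hξ.nonneg (norm_nonneg (u 0))
    have hub : Q ≤ p * ‖x₀‖ ^ 2 := re_inner_le_mul_norm_sq hPp x₀
    have hlb : k * ‖x₀‖ ^ 2 ≤ Q := hcoer x₀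
    have hpos : 0 < 1 + Q := by positivity
    -- The decay rate α comes from 1 + Q ≤ 1 + p‖x₀‖²; for the gain, `t2` uses 1 ≤ 1 + Q and `t3`
    -- uses k‖x₀‖² ≤ 1 + Q.
    have t1 : (1 / 2 * ‖x₀‖ ^ 2) / (1 + p * ‖x₀‖ ^ 2) * (1 + Q) ≤ 1 / 2 * ‖x₀‖ ^ 2 := by
      rw [div_mul_eq_mul_div, div_le_iff₀ (by positivity)]
      gcongr
    have t2 : 2 * p ^ 2 * ‖B‖ ^ 2 * ‖u 0‖ ^ 2 ≤ 2 * p ^ 2 * ‖B‖ ^ 2 * ‖u 0‖ ^ 2 * (1 + Q) :=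
      le_mul_of_one_le_right (by positivity) (by linarith)
    have t3 : 2 * p * K * ‖x₀‖ ^ 2 * ξ ‖u 0‖ ≤ 2 * p * K / k * ξ ‖u 0‖ * (1 + Q) := by
      have : 2 * p * K * ‖x₀‖ ^ 2 * ξ ‖u 0‖ = 2 * p * K / k * ξ ‖u 0‖ * (k * ‖x₀‖ ^ 2) := by
        field_simp
      rw [this]
      gcongr
      linarith
    rw [div_le_iff₀ hpos, bilinearGain]
    linarith

/-- The bilinear system is iISS. -/
theorem isIISS_bilinearRHS (T : C0Semigroup 𝕜 X) (B : U →L[𝕜] X)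
    {C : X → U → X} {K : ℝ} (hK : 0 < K) {ξ : ℝ → ℝ} (hξ : ClassK ξ)
    (hC : ∀ x v, ‖C x v‖ ≤ K * ‖x‖ * ξ ‖v‖) (hf : NonlinearityAssumption (bilinearRHS B C))
    {P : X →L[𝕜] X} (hPsa : IsSelfAdjoint P) (hPcoer : IsCoerciveOperator P)
    (hP : SolvesLyapunovEquation T.generator P) : IsIISS T (bilinearRHS B C) := by
  refine ⟨hasTransitionMap_of_linear_growth hf (bilinearRHS_linear_growth B hK hξ hC) T, ?_⟩
  obtain ⟨k, hk, hcoer⟩ := hPcoer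
  set p : ℝ := ‖P‖ + 1 with hp
  have hp0 : 0 < p := by positivity
  have hPp : ‖P‖ ≤ p := by linarith
  have hQ0 : ∀ x, 0 ≤ RCLike.re (inner 𝕜 (P x) x) := fun x =>
    le_trans (by positivity) (hcoer x)
  have hσ := classK_bilinearGain hp0 hk hK ‖B‖ hξ
  have hG : ClassKInfty fun s => Real.sqrt ((s + s ^ 2 / 2) / k) := by
    refine classKInfty_sqrt.comp (γ := fun s => (s + s ^ 2 / 2) / k)
      (classKInfty_of_le (c := 1 / k) (by fun_prop) (by simp) (fun a ha b _ hab => ?_)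
        (by positivity) fun r hr => ?_)
    · have := mem_Ici.1 ha
      gcongr
    · rw [one_div, inv_mul_eq_div]
      gcongr
      linarith [sq_nonneg r]
  have hθ : ClassKInfty fun s => Real.sqrt (((Real.exp s - 1) ^ 2 / 2 + s * Real.exp s) / k) := by
    refine classKInfty_sqrt.comp (γ := fun s => ((Real.exp s - 1) ^ 2 / 2 + s * Real.exp s) / k)
      (classKInfty_of_le (c := 1 / k) (by fun_prop) (by simp) (fun a ha b _ hab => ?_)
        (by positivity) fun r hr => ?_)
    · have h0 := mem_Ici.1 ha
      have h1 : 0 ≤ Real.exp a - 1 := by linarith [Real.one_le_exp h0]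
      gcongr
    · rw [one_div, inv_mul_eq_div]
      gcongr
      nlinarith [sq_nonneg (Real.exp r - 1), Real.one_le_exp hr]
  -- The rate 1/(2p) arises because Q ≤ p‖x‖² turns the decay ½‖x‖² into at least Q/(2p).
  refine ⟨_, bilinearGain p k K ‖B‖ ξ, _, hθ, hσ,
    classKL_exp_decay hG hp0 (by positivity : 0 < 1 / (2 * p)), ?_⟩
  intro x₀ u x hu hx t ht
  have htτ : t ∈ Icc 0 (t + 1) := ⟨ht, by linarith⟩
  obtain ⟨g, hg, hgx, hxm⟩ := (hx (t + 1) (by linarith)).exists_mild hf hu (by linarith)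
  have hu' : Continuous fun s : ℝ => ‖u (max 0 s)‖ :=
    (ContinuousOn.comp_continuous hu (by fun_prop) fun s => mem_Ici.2 (le_max_left 0 s)).norm
  have hm : Continuous fun s : ℝ => bilinearGain p k K ‖B‖ ξ ‖u (max 0 s)‖ :=
    hσ.continuousOn.comp_continuous hu' fun s => norm_nonneg _
  have hmc := T.continuous_mild x₀ hg
  have hmain := le_of_deriv_right_le
    (q := fun s => RCLike.re (inner 𝕜 (P (T.mild x₀ g s)) (T.mild x₀ g s)))
    (c := 1 / (2 * p)) (by positivity) ht (by fun_prop) hm (fun s => hσ.nonneg (norm_nonneg _))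
    (fun s hs => T.hasDerivWithinAt_energy hPsa hP x₀ hg hs.1) fun s hs => by
      have hs' : s ∈ Icc 0 (t + 1) := ⟨hs.1, by linarith [hs.2]⟩
      rw [hgx s hs', ← hxm s hs', max_eq_right hs.1]
      have hdis := dissipation_le B hC hPp (x s) (u s)
      have hξ0 := hξ.nonneg (norm_nonneg (u s))
      have hub := re_inner_le_mul_norm_sq hPp (x s)
      have hlb := hcoer (x s)
      have hQn := hQ0 (x s)
      generalize RCLike.re (inner 𝕜 (P (x s)) (x s)) = Q at hub hlb hQn ⊢
      have t1 : 1 / (2 * p) * Q ≤ 1 / 2 * ‖x s‖ ^ 2 := by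
        rw [div_mul_eq_mul_div, one_mul, div_le_iff₀ (by positivity)]
        linarith
      have t2 : 2 * p ^ 2 * ‖B‖ ^ 2 * ‖u s‖ ^ 2 ≤ 2 * p ^ 2 * ‖B‖ ^ 2 * ‖u s‖ ^ 2 * (1 + Q) :=
        le_mul_of_one_le_right (by positivity) (by linarith)
      have t3 : 2 * p * K * ‖x s‖ ^ 2 * ξ ‖u s‖ ≤ 2 * p * K / k * ξ ‖u s‖ * (1 + Q) := by
        have : 2 * p * K * ‖x s‖ ^ 2 * ξ ‖u s‖ = 2 * p * K / k * ξ ‖u s‖ * (k * ‖x s‖ ^ 2) := by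
          field_simp
        rw [this]
        gcongr
        linarith
      rw [bilinearGain]
      linarith
  have hIeq : (∫ s in (0 : ℝ)..t, bilinearGain p k K ‖B‖ ξ ‖u (max 0 s)‖) =
      ∫ s in (0 : ℝ)..t, bilinearGain p k K ‖B‖ ξ ‖u s‖ := by
    refine intervalIntegral.integral_congr fun s hs => ?_
    rw [uIcc_of_le ht] at hs
    simp only [max_eq_right hs.1]
  have hI0 : 0 ≤ ∫ s in (0 : ℝ)..t, bilinearGain p k K ‖B‖ ξ ‖u s‖ :=
    intervalIntegral.integral_nonneg ht fun s _ => hσ.nonneg (norm_nonneg _)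
  simp only [T.mild_zero, ← hxm t htτ] at hmain
  rw [hIeq] at hmain
  generalize (∫ s in (0 : ℝ)..t, bilinearGain p k K ‖B‖ ξ ‖u s‖) = I at hmain hI0 ⊢
  have hlb := hcoer (x t)
  have hub := re_inner_le_mul_norm_sq hPp x₀
  set y : ℝ := p * ‖x₀‖ ^ 2 * Real.exp (-(1 / (2 * p) * t)) with hy
  have hy0 : 0 ≤ y := by positivity
  have hyle : Real.exp (-(1 / (2 * p) * t)) * RCLike.re (inner 𝕜 (P x₀) x₀) ≤ y := by
    rw [hy, mul_comm]
    gcongr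
  -- The product is separated by e^I y = y + (e^I - 1)y ≤ y + y²/2 + (e^I - 1)²/2. The two groups,
  -- divided by k and under square roots, give β and θ.
  have hbound : k * ‖x t‖ ^ 2 ≤
      (y + y ^ 2 / 2) + ((Real.exp I - 1) ^ 2 / 2 + I * Real.exp I) := by
    have h1 : k * ‖x t‖ ^ 2 ≤ Real.exp I * (y + I) :=
      (hlb.trans hmain).trans (by gcongr)
    nlinarith [sq_nonneg (Real.exp I - 1 - y)]
  have hnorm : ‖x t‖ ≤ Real.sqrt ((y + y ^ 2 / 2) / k +
      ((Real.exp I - 1) ^ 2 / 2 + I * Real.exp I) / k) := by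
    refine Real.le_sqrt_of_sq_le ?_
    rw [← add_div, le_div_iff₀ hk]
    linarith
  exact hnorm.trans (sqrt_add_le_add_sqrt (by positivity) (by positivity))

end Bilinear

end IISS

/-- Along mild solutions `⟨Px, x⟩` is right differentiable for every `C₀`-semigroup and every initial
state, so that the conclusions follow from the Lyapunov equation alone: neither analyticity of the
semigroup nor invariance of `D(A)` enters the argument. -/
theorem mainTheorem2 {𝕜 X U : Type*} [RCLike 𝕜]
    [NormedAddCommGroup X] [InnerProductSpace 𝕜 X] [CompleteSpace X]
    [NormedSpace ℝ X] [IsScalarTower ℝ 𝕜 X]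
    [NormedAddCommGroup U] [NormedSpace 𝕜 U] [CompleteSpace U]
    (T : IISS.C0Semigroup 𝕜 X) (B : U →L[𝕜] X) (C : X → U → X)
    (K : ℝ) (hK : 0 < K) (ξ : ℝ → ℝ) (hξ : IISS.ClassK ξ)
    (hC : ∀ x v, ‖C x v‖ ≤ K * ‖x‖ * ξ ‖v‖)
    (hf : IISS.NonlinearityAssumption (IISS.bilinearRHS B C))
    (P : X →L[𝕜] X) (hPsa : IsSelfAdjoint P) (hPpos : IISS.IsPositiveOperator P)
    (hPcoer : IISS.IsCoerciveOperator P)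
    (hPlyap : IISS.SolvesLyapunovEquation T.generator P) :
    (T.IsAnalytic →
      IISS.IsIISS T (IISS.bilinearRHS B C) ∧
        IISS.IsIISSLyapunovFunction T (IISS.bilinearRHS B C) (IISS.logLyapunov P)) ∧
    (IISS.DomainInvariant T (IISS.bilinearRHS B C) →
      IISS.IsIISS T (IISS.bilinearRHS B C) ∧
        IISS.IsIISSLyapunovFunctionOn T (IISS.bilinearRHS B C) (T.domain : Set X)
          (IISS.logLyapunov P)) := by
  have hiiss := IISS.isIISS_bilinearRHS T B hK hξ hC hf hPsa hPcoer hPlyap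
  have hlyap := IISS.isIISSLyapunovFunctionOn_logLyapunov T B hK hξ hC hf hPsa hPcoer hPlyap
  exact ⟨fun _ => ⟨hiiss, hlyap univ⟩, fun _ => ⟨hiiss, hlyap T.domain⟩⟩
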